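/- **Conventions.** A *locally C\*-algebra* is a complete Hausdorff complex topological \*-algebra $A$ (not necessarily unital) whose topology is determined by its continuous C\*-seminorms; $S(A)$ is the set of all continuous C\*-seminorms on $A$. For $p\in S(A)$, $N_p=\{a: p(a)=0\}$, $A_p=A/N_p$ is the C\*-algebra with the norm induced by $p$, and $\pi_p:A\to A_p$ is the quotient map. A *Hilbert $A$-module* $V$ is a right $A$-module with an $A$-valued positive definite inner product, linear in the second variable, complete for the seminorms $\bar p_V(x)=p(\langle x,x\rangle)^{1/2}$, $p\in S(A)$; it is *full* if $\langle V,V\rangle$ spans a dense subspace of $A$. Put $N_p^V=\{x:\bar p_V(x)=0\}$, $V_p=V/N_p^V$, a Hilbert $A_p$-module with $\langle\sigma_p^V(x),\sigma_p^V(y)\rangle=\pi_p(\langle x,y\rangle)$, where $\sigma_p^V:V\to V_p$ is the quotient map. For a Hilbert $B$-module $E$, $L_B(E)$ is the \*-algebra of bounded adjointable $B$-module maps on $E$ with the topology given by the seminorms $\tilde q(T)=\|(\pi_q)_*(T)\|$, $q\in S(B)$, where $(\pi_q)_*:L_B(E)\to L_{B_q}(E_q)$, $(\pi_q)_*(T)(\sigma_q^E(x))=\sigma_q^E(Tx)$.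 A \*-morphism $\Psi:A\to L_B(E)$ is *non-degenerate* (or: $A$ acts non-degenerately on $E$) if $\Psi(A)E$ spans a dense subspace of $E$. A *representation* of a Hilbert $A$-module $V$ is a map $\Phi:V\to B(H,K)$, $H,K$ Hilbert spaces, with $\Phi(x)^*\Phi(y)=\varphi(\langle x,y\rangle)$ for all $x,y\in V$, where $\varphi:A\to B(H)$ is a continuous \*-morphism. It is *non-degenerate* if $\Phi(V)H$ spans a dense subspace of $K$ and $\Phi(V)^*K$ spans a dense subspace of $H$; and $\varphi$ is *non-degenerate* if $\varphi(A)H$ spans a dense subspace of $H$. Two representations $\Phi_i:V\to B(H_i,K_i)$ are *unitarily equivalent* if there are unitaries $U_1:H_1\to H_2$, $U_2:K_1\to K_2$ with $U_2\Phi_1(v)=\Phi_2(v)U_1$ for all $v\in V$. If $\Phi:W\to B(H,K)$ is a representation of a Hilbert $B$-module $W$ with underlying $\varphi:B\to B(H)$, $q\in S(B)$, and $\varphi_q:B_q\to B(H)$ is a \*-morphism with $\varphi_q\circ\pi_q=\varphi$ (a representation of $B_q$ *associated to* $\varphi$), then $\Phi_q:W_q\to B(H,K)$, $\Phi_q(\sigma_q^W(w))=\Phi(w)$,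 is a representation of $W_q$ with underlying $\varphi_q$. **Induced representations.** Let $V,W$ be Hilbert modules over $A,B$, let $E$ be a Hilbert $B$-module, $\Psi:A\to L_B(E)$ a continuous \*-morphism, and $\Phi:W\to B(H,K)$ a representation with underlying $\varphi$. For a Hilbert $B$-module $F$, $_FH$ is the Hausdorff completion of $F\otimes_{alg}H$ for the semi-inner product $\langle x\otimes h,y\otimes k\rangle=\langle h,\varphi(\langle x,y\rangle)k\rangle$. The interior tensor product $V\otimes_\Psi E$ is the Hilbert $B$-module obtained as Hausdorff completion of the algebraic tensor product of $V$ and $E$ for $\langle v\otimes x,w\otimes y\rangle=\langle x,\Psi(\langle v,w\rangle)y\rangle$. The *Rieffel induced representation* from $W$ to $V$ via $E$ is the representation ${}_E^V\Phi:V\to B({}_EH,\,{}_{V\otimes_\Psi E}H)$ determined by ${}_E^V\Phi(v)(x\otimes h)=v\otimes x\otimes h$; its underlying representation of $A$ is ${}_E^A\varphi(a)(x\otimes h)=\Psi(a)x\otimes h$. **Theorem.** Let $V$ and $W$ be full Hilbert modules over locally C\*-algebras $A$ and $B$, respectively. Let $E$ be a Hilbert $B$-module, $\Psi:A\to L_B(E)$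 a non-degenerate continuous \*-morphism, and $\Phi:W\to B(H,K)$ a non-degenerate representation of $W$ with underlying representation $\varphi$ of $B$. Let $q\in S(B)$ and let $\varphi_q:B_q\to B(H)$ be a non-degenerate representation of $B_q$ associated to $\varphi$. Then there are $p\in S(A)$ and a continuous \*-morphism $\Psi_p:A_p\to L_{B_q}(E_q)$ with $\Psi_p(\pi_p(a))=(\pi_q)_*(\Psi(a))$ for all $a\in A$, such that $\Psi_p$ is non-degenerate (so $A_p$ acts non-degenerately on $E_q$) and the representations ${}_E^V\Phi$ and ${}_{E_q}^{V_p}\Phi_q\circ\sigma_p^V$ of $V$ are unitarily equivalent, where ${}_{E_q}^{V_p}\Phi_q$ is the Rieffel induced representation from $W_q$ to $V_p$ via $E_q$ and $\Psi_p$. -/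

import Mathlib

namespace LocCStar

open scoped Topology RightActions TensorProduct
open Filter

noncomputable section

set_option linter.unusedSectionVars false

section

/-- A C⋆-seminorm on a complex ⋆-algebra. -/
structure CStarSeminorm (A : Type*) [NonUnitalRing A] [StarRing A] [Module ℂ A] extends
    Seminorm ℂ A where
  mul_le' : ∀ a b : A, toFun (a * b) ≤ toFun a * toFun b
  star_mul_self' : ∀ a : A, toFun (star a * a) = toFun a ^ 2

/-- A locally C⋆-algebra (not necessarily unital): a complete Hausdorff complex topological
⋆-algebra whose topology is determined by its continuous C⋆-seminorms. -/
class LocallyCStarAlgebra (A : Type*) extends NonUnitalRing A, StarRing A, Module ℂ A,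
    IsScalarTower ℂ A A, SMulCommClass ℂ A A, StarModule ℂ A, UniformSpace A,
    IsUniformAddGroup A, T2Space A, CompleteSpace A where
  nhds_zero_eq : 𝓝 (0 : A) =
    ⨅ p : {p : CStarSeminorm A // Continuous p.toSeminorm}, comap p.1.toSeminorm (𝓝 0)

/-- `S(A)`: the set of continuous C⋆-seminorms on `A`. -/
def S (A : Type*) [LocallyCStarAlgebra A] : Type _ :=
  {p : CStarSeminorm A // Continuous p.toSeminorm}

variable {A : Type*} [LocallyCStarAlgebra A]

namespace S

instance : FunLike (S A) A ℝ where
  coe p := p.1.toSeminorm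
  coe_injective := by
    rintro ⟨⟨p, _, _⟩, _⟩ ⟨⟨q, _, _⟩, _⟩ h
    congr
    exact DFunLike.coe_injective h

instance : SeminormClass (S A) ℂ A where
  map_zero p := map_zero p.1.toSeminorm
  map_add_le_add p := map_add_le_add p.1.toSeminorm
  map_neg_eq_map p := map_neg_eq_map p.1.toSeminorm
  map_smul_eq_mul p := map_smul_eq_mul p.1.toSeminorm

theorem mul_le (p : S A) (a b : A) : p (a * b) ≤ p a * p b := p.1.mul_le' a b

theorem star_mul_self (p : S A) (a : A) : p (star a * a) = p a ^ 2 := p.1.star_mul_self' a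

theorem continuous (p : S A) : Continuous p := p.2

theorem star_le (p : S A) (a : A) : p a ≤ p (star a) := by
  by_cases h : p a = 0
  · rw [h]; exact apply_nonneg p _
  have h0 : 0 < p a := lt_of_le_of_ne (apply_nonneg p a) (Ne.symm h)
  have := p.mul_le (star a) a
  rw [star_mul_self, sq] at this
  exact le_of_mul_le_mul_right this h0

@[simp]
theorem map_star (p : S A) (a : A) : p (star a) = p a :=
  le_antisymm (by simpa using p.star_le (star a)) (p.star_le a)

/-- `S(A)` is directed: the maximum of two continuous C⋆-seminorms is one. -/
theorem exists_max (p q : S A) : ∃ r : S A, ∀ a, r a = max (p a) (q a) := by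
  refine ⟨⟨⟨p.1.toSeminorm ⊔ q.1.toSeminorm, fun a b => ?_, fun a => ?_⟩, ?_⟩, fun a => rfl⟩
  · change max (p (a * b)) (q (a * b)) ≤ max (p a) (q a) * max (p b) (q b)
    refine max_le ((p.mul_le a b).trans ?_) ((q.mul_le a b).trans ?_)
    · exact mul_le_mul (le_max_left _ _) (le_max_left _ _) (apply_nonneg p b)
        ((apply_nonneg p a).trans (le_max_left _ _))
    · exact mul_le_mul (le_max_right _ _) (le_max_right _ _) (apply_nonneg q b)
        ((apply_nonneg q a).trans (le_max_right _ _))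
  · change max (p (star a * a)) (q (star a * a)) = max (p a) (q a) ^ 2
    rw [p.star_mul_self, q.star_mul_self]
    rcases le_total (p a) (q a) with h | h
    · rw [max_eq_right h, max_eq_right (pow_le_pow_left₀ (apply_nonneg p a) h 2)]
    · rw [max_eq_left h, max_eq_left (pow_le_pow_left₀ (apply_nonneg q a) h 2)]
  · exact p.2.sup q.2

instance : Nonempty (S A) :=
  ⟨⟨⟨0, fun _ _ => (mul_zero (0 : ℝ)).ge, fun _ => (zero_pow two_ne_zero).symm⟩, continuous_const⟩⟩

end S

theorem nhds_zero_basis : (𝓝 (0 : A)).HasBasis (fun i : S A × ℝ => 0 < i.2)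
    fun i => {a | i.1 a < i.2} := by
  rw [LocallyCStarAlgebra.nhds_zero_eq]
  change (⨅ p : S A, comap p (𝓝 0)).HasBasis _ _
  have hb : ∀ p : S A, (comap p (𝓝 0)).HasBasis (fun ε : ℝ => 0 < ε) fun ε => {a | p a < ε} := by
    intro p
    convert (nhds_basis_abs_sub_lt (0 : ℝ)).comap p using 2 with ε
    ext a
    simp [abs_of_nonneg (apply_nonneg p a)]
  have hd : Directed (· ≥ ·) fun p : S A => comap p (𝓝 (0 : ℝ)) := by
    intro p q
    obtain ⟨r, hr⟩ := S.exists_max p q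
    refine ⟨r, ?_, ?_⟩
    · refine ((hb r).le_basis_iff (hb p)).2 fun ε hε => ⟨ε, hε, fun a ha => ?_⟩
      exact lt_of_le_of_lt ((le_max_left _ _).trans (hr a).ge) ha
    · refine ((hb r).le_basis_iff (hb q)).2 fun ε hε => ⟨ε, hε, fun a ha => ?_⟩
      exact lt_of_le_of_lt ((le_max_right _ _).trans (hr a).ge) ha
  constructor
  intro t
  rw [mem_iInf_of_directed hd]
  constructor
  · rintro ⟨p, hp⟩
    obtain ⟨ε, hε, h⟩ := (hb p).mem_iff.1 hp
    exact ⟨(p, ε), hε, h⟩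
  · rintro ⟨⟨p, ε⟩, hε, h⟩
    exact ⟨p, (hb p).mem_iff.2 ⟨ε, hε, h⟩⟩

theorem tendsto_zero_iff {ι : Type*} {l : Filter ι} {u : ι → A} :
    Tendsto u l (𝓝 0) ↔ ∀ p : S A, Tendsto (fun i => p (u i)) l (𝓝 0) := by
  rw [LocallyCStarAlgebra.nhds_zero_eq]
  simp only [tendsto_iInf, tendsto_comap_iff]
  rfl

theorem eq_zero_of_forall {a : A} (h : ∀ p : S A, p a = 0) : a = 0 := by
  have h1 : Tendsto (fun _ : ℕ => a) atTop (𝓝 0) := by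
    rw [tendsto_zero_iff]; intro p; simp [h p]
  exact tendsto_nhds_unique tendsto_const_nhds h1

theorem cauchySeq_of_forall {u : ℕ → A}
    (h : ∀ p : S A, ∀ ε > 0, ∃ N, ∀ m ≥ N, ∀ n ≥ N, p (u m - u n) < ε) : CauchySeq u := by
  rw [cauchySeq_iff_tendsto, uniformity_eq_comap_nhds_zero A, tendsto_comap_iff]
  refine (nhds_zero_basis (A := A)).tendsto_right_iff.2 ?_
  rintro ⟨p, ε⟩ hε
  obtain ⟨N, hN⟩ := h p ε hε
  filter_upwards [eventually_ge_atTop ((N, N) : ℕ × ℕ)] with x hx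
  have := hN x.2 hx.2 x.1 hx.1
  simpa using this

/-! ### The quotient C⋆-algebras `A_p` -/

/-- A copy of `A` carrying the seminorm `p` as its only topological structure. -/
def WithS (p : S A) : Type _ := (fun _ => A) p

namespace WithS

variable (p : S A)

instance : NonUnitalRing (WithS p) := inferInstanceAs (NonUnitalRing A)
instance : StarRing (WithS p) := inferInstanceAs (StarRing A)
instance : Module ℂ (WithS p) := inferInstanceAs (Module ℂ A)
instance : IsScalarTower ℂ (WithS p) (WithS p) := inferInstanceAs (IsScalarTower ℂ A A)
instance : SMulCommClass ℂ (WithS p) (WithS p) := inferInstanceAs (SMulCommClass ℂ A A)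
instance : StarModule ℂ (WithS p) := inferInstanceAs (StarModule ℂ A)

/-- The identity map from `A` to its copy. -/
def of : A →⋆ₙₐ[ℂ] WithS p := NonUnitalStarAlgHom.id ℂ A

instance : SeminormedAddCommGroup (WithS p) where
  __ := (NonUnitalRing.toNonUnitalNonAssocRing.toAddCommGroup : AddCommGroup (WithS p))
  __ := @AddGroupSeminorm.toSeminormedAddCommGroup (WithS p) _ p.1.toSeminorm.toAddGroupSeminorm

theorem norm_of (a : A) : ‖of p a‖ = p a := rfl

instance : NonUnitalSeminormedRing (WithS p) where
  __ := (inferInstance : NonUnitalRing (WithS p))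
  __ := (inferInstance : SeminormedAddCommGroup (WithS p))
  norm_mul_le := p.mul_le

instance : NormedSpace ℂ (WithS p) where
  __ := (inferInstance : Module ℂ (WithS p))
  norm_smul_le c a := (map_smul_eq_mul p c a).le

instance : NormedStarGroup (WithS p) where
  norm_star_le a := (p.map_star a).le

end WithS

/-- `A_p = A / N_p`, `N_p = {a | p a = 0}`, with the norm induced by `p`. (The separation
quotient of a seminormed group is its quotient by the elements of seminorm zero.) -/
def Quo (p : S A) : Type _ := SeparationQuotient (WithS p)

namespace Quo

variable (p : S A)

instance instNonUnitalNormedRing : NonUnitalNormedRing (Quo p) :=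
  inferInstanceAs (NonUnitalNormedRing (SeparationQuotient (WithS p)))

instance instNormedSpace : NormedSpace ℂ (Quo p) :=
  inferInstanceAs (NormedSpace ℂ (SeparationQuotient (WithS p)))

instance : IsScalarTower ℂ (Quo p) (Quo p) where
  smul_assoc c := by
    refine Quotient.ind₂ fun a b => ?_
    exact congrArg SeparationQuotient.mk (smul_assoc c a b)

instance : SMulCommClass ℂ (Quo p) (Quo p) where
  smul_comm c := by
    refine Quotient.ind₂ fun a b => ?_
    exact congrArg SeparationQuotient.mk (smul_comm c a b)

instance : Star (Quo p) where
  star := SeparationQuotient.lift (fun a => SeparationQuotient.mk (star a))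
    fun _ _ h => SeparationQuotient.mk_eq_mk.2 (h.map continuous_star)

instance instStarRing : StarRing (Quo p) where
  star_involutive := Quotient.ind fun a => congrArg SeparationQuotient.mk (star_star a)
  star_mul := Quotient.ind₂ fun a b => congrArg SeparationQuotient.mk (star_mul a b)
  star_add := Quotient.ind₂ fun a b => congrArg SeparationQuotient.mk (star_add a b)

instance : StarModule ℂ (Quo p) where
  star_smul c := Quotient.ind fun a => congrArg SeparationQuotient.mk (star_smul c a)

instance : CStarRing (Quo p) where
  norm_mul_self_le := Quotient.ind fun a => by
    have := (p.star_mul_self a).ge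
    rw [sq] at this
    exact this

end Quo

/-- The canonical map `π_p : A → A_p`. -/
def π (p : S A) : A →⋆ₙₐ[ℂ] Quo p where
  toFun a := SeparationQuotient.mk (WithS.of p a)
  map_smul' _ _ := rfl
  map_zero' := rfl
  map_add' _ _ := rfl
  map_mul' _ _ := rfl
  map_star' _ := rfl

theorem π_surjective (p : S A) : Function.Surjective (π p) :=
  SeparationQuotient.surjective_mk (X := WithS p)

@[simp]
theorem norm_π (p : S A) (a : A) : ‖π p a‖ = p a := rfl

theorem π_eq_zero {p : S A} {a : A} : π p a = 0 ↔ p a = 0 := by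
  rw [← norm_π, norm_eq_zero]

theorem π_continuous (p : S A) : Continuous (π p) := by
  refine continuous_of_continuousAt_zero (π p) ?_
  rw [ContinuousAt, map_zero, tendsto_zero_iff_norm_tendsto_zero]
  have := p.continuous.tendsto 0
  rwa [map_zero] at this

end

section

section Ambient

open UniformSpace

variable (Y : Type*) [NormedRing Y] [StarRing Y] [CStarRing Y] [NormedAlgebra ℂ Y] [StarModule ℂ Y]

/-- The C⋆-algebra obtained by completing a unital pre-C⋆-algebra. -/
def CStarCompletion : Type _ := Completion Y

namespace CStarCompletion

instance : NormedRing (CStarCompletion Y) := inferInstanceAs (NormedRing (Completion Y))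

instance : NormedSpace ℂ (CStarCompletion Y) := inferInstanceAs (NormedSpace ℂ (Completion Y))

instance : CompleteSpace (CStarCompletion Y) := inferInstanceAs (CompleteSpace (Completion Y))

variable {Y}

/-- The inclusion into the completion. -/
def of (y : Y) : CStarCompletion Y := (y : Completion Y)

theorem of_add (x y : Y) : of (x + y) = of x + of y := Completion.coe_add x y
theorem of_mul (x y : Y) : of (x * y) = of x * of y := Completion.coe_mul x y
theorem of_smul (c : ℂ) (y : Y) : of (c • y) = c • of y := Completion.coe_smul c y
theorem norm_of (y : Y) : ‖of y‖ = ‖y‖ := Completion.norm_coe y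

theorem denseRange_of : DenseRange (of : Y → CStarCompletion Y) := Completion.denseRange_coe

theorem ind {P : CStarCompletion Y → Prop} (hP : IsClosed {a | P a}) (h : ∀ y, P (of y))
    (a : CStarCompletion Y) : P a :=
  denseRange_of.induction_on a hP h

theorem smul_mul' (c : ℂ) (x y : CStarCompletion Y) : (c • x) * y = c • (x * y) := by
  have hs : Continuous fun z : CStarCompletion Y => c • z := continuous_const_smul c
  have hr : ∀ w : CStarCompletion Y, Continuous fun z => z * w := continuous_mul_const
  have hl : ∀ w : CStarCompletion Y, Continuous fun z => w * z := continuous_const_mul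
  refine ind (P := fun x => (c • x) * y = c • (x * y))
    (isClosed_eq ((hr y).comp hs) (hs.comp (hr y))) (fun x => ?_) x
  refine ind (P := fun y => (c • of x) * y = c • (of x * y))
    (isClosed_eq (hl _) (hs.comp (hl _))) (fun y => ?_) y
  rw [← of_smul, ← of_mul, ← of_mul, ← of_smul, smul_mul_assoc]

theorem mul_smul' (c : ℂ) (x y : CStarCompletion Y) : x * (c • y) = c • (x * y) := by
  have hs : Continuous fun z : CStarCompletion Y => c • z := continuous_const_smul c
  have hr : ∀ w : CStarCompletion Y, Continuous fun z => z * w := continuous_mul_const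
  have hl : ∀ w : CStarCompletion Y, Continuous fun z => w * z := continuous_const_mul
  refine ind (P := fun x => x * (c • y) = c • (x * y))
    (isClosed_eq (hr _) (hs.comp (hr _))) (fun x => ?_) x
  refine ind (P := fun y => of x * (c • y) = c • (of x * y))
    (isClosed_eq ((hl _).comp hs) (hs.comp (hl _))) (fun y => ?_) y
  rw [← of_smul, ← of_mul, ← of_mul, ← of_smul, mul_smul_comm]

instance : NormedAlgebra ℂ (CStarCompletion Y) where
  __ := Algebra.ofModule (R := ℂ) (A := CStarCompletion Y) smul_mul' mul_smul'
  norm_smul_le c x := norm_smul_le c x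

instance : Star (CStarCompletion Y) where
  star := (Completion.map (star : Y → Y) : Completion Y → Completion Y)

theorem of_star (y : Y) : of (star y) = star (of y) :=
  (Completion.map_coe (star_isometry (E := Y)).uniformContinuous y).symm

theorem continuous_star' : Continuous (star : CStarCompletion Y → CStarCompletion Y) :=
  Completion.continuous_map (f := (star : Y → Y))

instance : StarRing (CStarCompletion Y) where
  star_involutive x := by
    have hc := continuous_star' (Y := Y)
    induction x using ind with
    | hP => exact isClosed_eq (hc.comp hc) continuous_id
    | h x => rw [← of_star, ← of_star, star_star]
  star_mul x y := by
    have hc := continuous_star' (Y := Y)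
    induction x using ind with
    | hP => exact isClosed_eq (by fun_prop) (by fun_prop)
    | h x =>
      induction y using ind with
      | hP => exact isClosed_eq (by fun_prop) (by fun_prop)
      | h y => simp only [← of_star, ← of_mul, star_mul]
  star_add x y := by
    have hc := continuous_star' (Y := Y)
    induction x using ind with
    | hP => exact isClosed_eq (by fun_prop) (by fun_prop)
    | h x =>
      induction y using ind with
      | hP => exact isClosed_eq (by fun_prop) (by fun_prop)
      | h y => simp only [← of_star, ← of_add, star_add]

instance : CStarRing (CStarCompletion Y) where
  norm_mul_self_le x := by
    have hc := continuous_star' (Y := Y)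
    induction x using ind with
    | hP => exact isClosed_le (by fun_prop) (by fun_prop)
    | h x => rw [← of_star, ← of_mul, norm_of, norm_of, CStarRing.norm_star_mul_self]

instance : StarModule ℂ (CStarCompletion Y) where
  star_smul c x := by
    have hc := continuous_star' (Y := Y)
    have hs : ∀ c : ℂ, Continuous fun z : CStarCompletion Y => c • z := continuous_const_smul
    refine ind (P := fun x => star (c • x) = star c • star x)
      (isClosed_eq (hc.comp (hs c)) ((hs (star c)).comp hc)) (fun x => ?_) x
    rw [← of_star, ← of_smul, ← of_smul, ← of_star, star_smul]

instance : CStarAlgebra (CStarCompletion Y) where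

end CStarCompletion

end Ambient

variable {A : Type*} [LocallyCStarAlgebra A]

/-- For `p ∈ S(A)` there is a ⋆-homomorphism `ρ` into a C⋆-algebra with `‖ρ a‖ = p a`. -/
def ambient (p : S A) : A →⋆ₙₐ[ℂ] CStarCompletion (Unitization ℂ (Quo p)) where
  toFun a := CStarCompletion.of (π p a : Unitization ℂ (Quo p))
  map_smul' c a := by
    rw [map_smul, Unitization.inr_smul, CStarCompletion.of_smul]; rfl
  map_zero' := by
    rw [map_zero, Unitization.inr_zero, ← norm_eq_zero, CStarCompletion.norm_of, norm_zero]
  map_add' a b := by rw [map_add, Unitization.inr_add, CStarCompletion.of_add]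
  map_mul' a b := by rw [map_mul, Unitization.inr_mul, CStarCompletion.of_mul]
  map_star' a := by rw [map_star, Unitization.inr_star, CStarCompletion.of_star]

theorem norm_ambient (p : S A) (a : A) : ‖ambient p a‖ = p a := by
  rw [← norm_π]
  exact (CStarCompletion.norm_of _).trans (Unitization.norm_inr (𝕜 := ℂ) (π p a))

/-! ### Functional calculus in a locally C⋆-algebra -/

universe u v

variable {A : Type u} [LocallyCStarAlgebra A]

theorem exists_poly (a : A) (ha : IsSelfAdjoint a) (Q : Polynomial ℝ) :
    ∃ y : A, ∀ (C : Type v) [NonUnitalCStarAlgebra C] (ρ : A →⋆ₙₐ[ℂ] C),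
      ρ y = cfcₙ (fun t : ℝ => t * Q.eval t) (ρ a) := by
  induction Q using Polynomial.induction_on' with
  | add P Q hP hQ =>
    obtain ⟨y, hy⟩ := hP
    obtain ⟨z, hz⟩ := hQ
    refine ⟨y + z, fun C _ ρ => ?_⟩
    have h : IsSelfAdjoint (ρ a) := ha.map ρ
    rw [map_add, hy, hz, ← cfcₙ_add _ _ _ (by fun_prop) (by simp) (by fun_prop) (by simp)]
    congr 1
    ext t
    simp [mul_add]
  | monomial n c =>
    induction n with
    | zero =>
      refine ⟨(c : ℂ) • a, fun C _ ρ => ?_⟩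
      have h : IsSelfAdjoint (ρ a) := ha.map ρ
      rw [map_smul]
      have : (fun t : ℝ => t * (Polynomial.monomial 0 c).eval t) = fun t => c * t := by
        ext t; simp [mul_comm]
      rw [this, cfcₙ_const_mul_id c (ρ a)]
      rfl
    | succ n ih =>
      obtain ⟨y, hy⟩ := ih
      refine ⟨y * a, fun C _ ρ => ?_⟩
      have h : IsSelfAdjoint (ρ a) := ha.map ρ
      have : (fun t : ℝ => t * (Polynomial.monomial (n + 1) c).eval t) =
          fun t => (t * (Polynomial.monomial n c).eval t) * t := by
        ext t; simp [pow_succ]; ring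
      rw [map_mul, hy, this, cfcₙ_mul (fun t => t * (Polynomial.monomial n c).eval t) (fun t => t)
        _ (by fun_prop) (by simp) (by fun_prop) rfl, cfcₙ_id' ℝ (ρ a)]

theorem exists_cfc (a : A) (ha : IsSelfAdjoint a) (f : ℝ → ℝ) (hf : Continuous f)
    (hf0 : f 0 = 0) :
    ∃ b : A, ∀ (p : S A) (C : Type u) [NonUnitalCStarAlgebra C] (ρ : A →⋆ₙₐ[ℂ] C),
      (∀ x, ‖ρ x‖ = p x) → ρ b = cfcₙ f (ρ a) := by
  have h1 : ∀ n : ℕ, ∃ y : A, ∀ (C : Type u) [NonUnitalCStarAlgebra C] (ρ : A →⋆ₙₐ[ℂ] C),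
      ‖ρ a‖ ≤ n → ‖ρ y - cfcₙ f (ρ a)‖ ≤ 2 / (n + 1) := by
    intro n
    obtain ⟨P, hP⟩ := exists_polynomial_near_of_continuousOn (-(n : ℝ)) n f hf.continuousOn
      (1 / (n + 1)) (by positivity)
    obtain ⟨y, hy⟩ := exists_poly a ha P.divX
    refine ⟨y, fun C _ ρ hρ => ?_⟩
    have h : IsSelfAdjoint (ρ a) := ha.map ρ
    rw [hy, ← cfcₙ_sub _ _ _ (by fun_prop) (by simp) hf.continuousOn hf0]
    refine norm_cfcₙ_le fun t ht => ?_
    have htn : |t| ≤ n := by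
      have := NonUnitalIsometricContinuousFunctionalCalculus.norm_quasispectrum_le (𝕜 := ℝ) (ρ a) ht
      rw [Real.norm_eq_abs] at this
      exact this.trans hρ
    have e : t * P.divX.eval t = P.eval t - P.eval 0 := by
      have := congrArg (Polynomial.eval t) P.divX_mul_X_add
      rw [Polynomial.eval_add, Polynomial.eval_mul, Polynomial.eval_X, Polynomial.eval_C,
        Polynomial.coeff_zero_eq_eval_zero] at this
      linarith
    have k1 := hP t (abs_le.1 htn)
    have k2 := hP 0 ⟨by simp, by simp⟩
    rw [hf0, sub_zero] at k2
    rw [e, Real.norm_eq_abs]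
    calc |P.eval t - P.eval 0 - f t| = |(P.eval t - f t) - P.eval 0| := by ring_nf
      _ ≤ |P.eval t - f t| + |P.eval 0| := abs_sub _ _
      _ ≤ 1 / (n + 1) + 1 / (n + 1) := add_le_add k1.le k2.le
      _ = 2 / (n + 1) := by ring
  choose y hy using h1
  have hlim : Tendsto (fun n : ℕ => (2 : ℝ) / (n + 1)) atTop (𝓝 0) := by
    have := (tendsto_one_div_add_atTop_nhds_zero_nat (𝕜 := ℝ)).const_mul 2
    simpa only [mul_one_div, mul_zero] using this
  have hev : ∀ (p : S A) (C : Type u) [NonUnitalCStarAlgebra C] (ρ : A →⋆ₙₐ[ℂ] C),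
      (∀ x, ‖ρ x‖ = p x) → ∀ ε > 0, ∃ N, ∀ n ≥ N, ‖ρ (y n) - cfcₙ f (ρ a)‖ < ε := by
    intro p C _ ρ hρ ε hε
    obtain ⟨N, hN⟩ := exists_nat_ge (p a)
    have := (hlim.eventually_lt_const hε).and (eventually_ge_atTop N)
    obtain ⟨M, hM⟩ := eventually_atTop.1 this
    refine ⟨M, fun n hn => (hy n C ρ ?_).trans_lt (hM n hn).1⟩
    rw [hρ]
    exact hN.trans (by exact_mod_cast (hM n hn).2)
  have hc : CauchySeq y := by
    refine cauchySeq_of_forall fun p ε hε => ?_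
    obtain ⟨N, hN⟩ := hev p _ (ambient p) (norm_ambient p) (ε / 2) (half_pos hε)
    refine ⟨N, fun m hm n hn => ?_⟩
    rw [← norm_ambient, map_sub]
    calc _ = ‖(ambient p (y m) - cfcₙ f (ambient p a))
          - (ambient p (y n) - cfcₙ f (ambient p a))‖ := by congr 1; abel
      _ ≤ _ := norm_sub_le _ _
      _ < ε / 2 + ε / 2 := add_lt_add (hN m hm) (hN n hn)
      _ = ε := add_halves ε
  obtain ⟨b, hb⟩ := cauchySeq_tendsto_of_complete hc
  refine ⟨b, fun p C _ ρ hρ => ?_⟩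
  have t1 : Tendsto (fun n => ρ (y n)) atTop (𝓝 (ρ b)) := by
    rw [tendsto_iff_norm_sub_tendsto_zero]
    have : Tendsto (fun n => y n - b) atTop (𝓝 0) := by
      simpa using hb.sub_const b
    have := tendsto_zero_iff.1 this p
    simpa only [← map_sub, hρ] using this
  have t2 : Tendsto (fun n => ρ (y n)) atTop (𝓝 (cfcₙ f (ρ a))) := by
    rw [tendsto_iff_norm_sub_tendsto_zero, Metric.tendsto_atTop]
    intro ε hε
    obtain ⟨N, hN⟩ := hev p C ρ hρ ε hε
    exact ⟨N, fun n hn => by simpa using hN n hn⟩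
  exact tendsto_nhds_unique t1 t2

/-- Every class of `A_p` has a representative that is bounded by the norm of the class. -/
theorem exists_bounded_lift (p : S A) (b : A) :
    ∃ b' : A, π p b' = π p b ∧ ∀ r : S A, r b' ≤ p b := by
  set s := p b with hs
  have hs0 : 0 ≤ s := apply_nonneg p b
  by_cases hs1 : s = 0
  · refine ⟨0, ?_, fun r => by rw [map_zero]; exact hs0⟩
    rw [map_zero, eq_comm, π_eq_zero]
    exact hs.symm.trans hs1
  have hspos : 0 < s := lt_of_le_of_ne hs0 (Ne.symm hs1)
  have hm : ∀ t, 0 < max s (√|t|) := fun t => lt_max_of_lt_left hspos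
  obtain ⟨g, hg⟩ : ∃ g : ℝ → ℝ, g = fun t => s / max s (√|t|) := ⟨_, rfl⟩
  have hgc : Continuous g := by
    rw [hg]
    exact continuous_const.div (by fun_prop) fun t => (hm t).ne'
  have hg0 : g 0 = 1 := by simp [hg, max_eq_left hs0, hs1]
  have hfc : Continuous fun t => 1 - g t := continuous_const.sub hgc
  have hf0 : 1 - g 0 = 0 := by rw [hg0, sub_self]
  have hsa : IsSelfAdjoint (star b * b) := IsSelfAdjoint.star_mul_self b
  obtain ⟨c, hc⟩ := exists_cfc (star b * b) hsa (fun t => 1 - g t) hfc hf0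
  have key : ∀ r : S A, ∃ h : CStarCompletion (Unitization ℂ (Quo r)),
      IsSelfAdjoint h ∧ star (ambient r b) * ambient r b = h ∧ ‖h‖ = r b ^ 2 ∧
      ambient r c = cfcₙ (fun t => 1 - g t) h := fun r =>
    ⟨_, hsa.map (ambient r), by rw [map_mul, map_star], by rw [norm_ambient, r.star_mul_self],
      hc r _ _ (norm_ambient r)⟩
  have ee : ∀ r : S A, ∀ x, r x ^ 2 = ‖star (ambient r x) * ambient r x‖ := fun r x => by
    rw [CStarRing.norm_star_mul_self, norm_ambient, sq]
  refine ⟨b - b * c, ?_, fun r => ?_⟩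
  · rw [map_sub, sub_eq_self, π_eq_zero, ← sq_eq_zero_iff, ee]
    obtain ⟨h, h1, h2, h3, h4⟩ := key p
    have h5 : star (cfcₙ (fun t => 1 - g t) h) = cfcₙ (fun t => 1 - g t) h :=
      cfcₙ_predicate (p := IsSelfAdjoint) (fun t : ℝ => 1 - g t) h
    rw [map_mul, h4, star_mul, mul_assoc, ← mul_assoc (star (ambient p b)), h2, h5, norm_eq_zero]
    have : cfcₙ (fun t => 1 - g t) h = 0 := by
      rw [← cfcₙ_const_zero ℝ h]
      refine cfcₙ_congr fun t ht => ?_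
      have h6 := NonUnitalIsometricContinuousFunctionalCalculus.norm_quasispectrum_le (𝕜 := ℝ) h ht
      rw [h3, Real.norm_eq_abs] at h6
      have h7 : √|t| ≤ s := by
        rw [← Real.sqrt_sq hs0]
        exact Real.sqrt_le_sqrt h6
      simp [hg, max_eq_left h7, hs1]
    rw [this, zero_mul]
  · rw [← abs_of_nonneg (apply_nonneg r (b - b * c)), ← abs_of_nonneg hs0, ← sq_le_sq, ee]
    obtain ⟨h, h1, h2, -, h4⟩ := key r
    have h5 : star (cfcₙ (fun t => 1 - g t) h) = cfcₙ (fun t => 1 - g t) h :=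
      cfcₙ_predicate (p := IsSelfAdjoint) (fun t : ℝ => 1 - g t) h
    obtain ⟨F, hF⟩ : ∃ F, F = cfcₙ (fun t => 1 - g t) h := ⟨_, rfl⟩
    have e1 : star (ambient r (b - b * c)) * ambient r (b - b * c) =
        (h - F * h) - (h - F * h) * F := by
      rw [map_sub, map_mul, h4, star_sub, star_mul, h5, ← hF, ← h2]
      noncomm_ring
    have e2 : F * h = cfcₙ (fun t => (1 - g t) * t) h := by
      rw [cfcₙ_mul (fun t => 1 - g t) (fun t => t) h hfc.continuousOn hf0 (by fun_prop) rfl, hF,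
        cfcₙ_id' ℝ h]
    have e3 : h - F * h = cfcₙ (fun t => t - (1 - g t) * t) h := by
      rw [cfcₙ_sub (fun t => t) (fun t => (1 - g t) * t) h (by fun_prop) rfl
        (by fun_prop) (by simp), ← e2, cfcₙ_id' ℝ h]
    have e4 : (h - F * h) * F = cfcₙ (fun t => (t - (1 - g t) * t) * (1 - g t)) h := by
      rw [cfcₙ_mul (fun t => t - (1 - g t) * t) (fun t => 1 - g t) h (by fun_prop) (by simp)
        hfc.continuousOn hf0, ← e3, hF]
    have e5 : (h - F * h) - (h - F * h) * F = cfcₙ (fun t => (t - (1 - g t) * t) -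
        (t - (1 - g t) * t) * (1 - g t)) h := by
      rw [cfcₙ_sub (fun t => t - (1 - g t) * t) (fun t => (t - (1 - g t) * t) * (1 - g t)) h
        (by fun_prop) (by simp) (by fun_prop) (by simp), ← e3, ← e4]
    rw [e1, e5]
    refine norm_cfcₙ_le fun t _ => ?_
    have e6 : (t - (1 - g t) * t) - (t - (1 - g t) * t) * (1 - g t) = t * g t ^ 2 := by ring
    rw [e6, Real.norm_eq_abs, abs_mul, abs_pow, sq_abs, hg]
    have h8 : |t| ≤ max s (√|t|) ^ 2 := by
      rw [← Real.sq_sqrt (abs_nonneg t)]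
      exact pow_le_pow_left₀ (Real.sqrt_nonneg _) (by simp) 2
    rw [div_pow, mul_div_assoc', div_le_iff₀ (pow_pos (hm t) 2), mul_comm]
    exact mul_le_mul_of_nonneg_left h8 (sq_nonneg s)

instance Quo.instCompleteSpace (p : S A) : CompleteSpace (Quo p) := by
  refine NormedAddCommGroup.completeSpace_of_summable_imp_tendsto fun u hu => ?_
  have : ∀ n, ∃ b : A, π p b = u n ∧ ∀ r : S A, r b ≤ ‖u n‖ := fun n => by
    obtain ⟨a, ha⟩ := π_surjective p (u n)
    obtain ⟨b, hb, hb'⟩ := exists_bounded_lift p a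
    exact ⟨b, hb.trans ha, fun r => by rw [← ha, norm_π]; exact hb' r⟩
  choose b hb hbr using this
  have hc : CauchySeq fun n => ∑ i ∈ Finset.range n, b i := by
    refine cauchySeq_of_forall fun r ε hε => ?_
    have h1 : CauchySeq fun n => ∑ i ∈ Finset.range n, ‖u i‖ := hu.hasSum.tendsto_sum_nat.cauchySeq
    obtain ⟨N, hN⟩ := Metric.cauchySeq_iff.1 h1 ε hε
    have main : ∀ m n, n ≤ m → r (∑ i ∈ Finset.range m, b i - ∑ i ∈ Finset.range n, b i) ≤
        ∑ i ∈ Finset.range m, ‖u i‖ - ∑ i ∈ Finset.range n, ‖u i‖ := by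
      intro m n hmn
      rw [← Finset.sum_Ico_eq_sub _ hmn, ← Finset.sum_Ico_eq_sub _ hmn]
      refine (Finset.le_sum_of_subadditive r (map_zero r).le (map_add_le_add r) _ _).trans (Finset.sum_le_sum fun i _ => hbr i r)
    refine ⟨N, fun m hm n hn => ?_⟩
    rcases le_total n m with h | h
    · refine (main m n h).trans_lt (lt_of_le_of_lt (le_abs_self _) ?_)
      simpa [Real.dist_eq] using hN m hm n hn
    · rw [map_sub_rev]
      refine (main n m h).trans_lt (lt_of_le_of_lt (le_abs_self _) ?_)
      simpa [Real.dist_eq] using hN n hn m hm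
  obtain ⟨a, ha⟩ := cauchySeq_tendsto_of_complete hc
  refine ⟨π p a, ?_⟩
  have := ((π_continuous p).tendsto a).comp ha
  refine this.congr fun n => ?_
  simp [map_sum, hb]

end

section

/-- Every C⋆-algebra is a locally C⋆-algebra. -/
@[reducible]
def ofCStarAlgebra (C : Type*) [NonUnitalCStarAlgebra C] : LocallyCStarAlgebra C where
  nhds_zero_eq := by
    refine le_antisymm (le_iInf fun p => ?_) ?_
    · rw [← tendsto_iff_comap]
      have := p.2.tendsto 0
      rwa [map_zero] at this
    · refine (iInf_le _ ⟨⟨normSeminorm ℂ C, norm_mul_le, fun a =>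
        (CStarRing.norm_star_mul_self).trans (sq ‖a‖).symm⟩, continuous_norm⟩).trans ?_
      exact (comap_norm_nhds_zero (E := C)).le

universe u

variable {A : Type u} [LocallyCStarAlgebra A]

instance Quo.instNonUnitalCStarAlgebra (p : S A) : NonUnitalCStarAlgebra (Quo p) where

instance Quo.instLocallyCStarAlgebra (p : S A) : LocallyCStarAlgebra (Quo p) :=
  ofCStarAlgebra (Quo p)

/-- The usual order of the C⋆-algebra `A_p`. -/
instance Quo.instPartialOrder (p : S A) : PartialOrder (Quo p) := CStarAlgebra.spectralOrder _

instance Quo.instStarOrderedRing (p : S A) : StarOrderedRing (Quo p) :=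
  CStarAlgebra.spectralOrderedRing _

/-- An element of a locally C⋆-algebra that is positive in every `A_p` is of the form `b⋆ b`. -/
theorem exists_star_mul_self_of_forall (a : A) (h : ∀ p : S A, 0 ≤ π p a) :
    ∃ b : A, a = star b * b := by
  have eq_of : ∀ x y : A, (∀ p : S A, π p x = π p y) → x = y := fun x y hxy => by
    rw [← sub_eq_zero]
    refine eq_zero_of_forall fun p => ?_
    rw [← π_eq_zero, map_sub, hxy p, sub_self]
  have ha : IsSelfAdjoint a := eq_of _ _ fun p => by
    rw [map_star]
    exact (h p).isSelfAdjoint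
  obtain ⟨b, hb⟩ := exists_cfc a ha Real.sqrt Real.continuous_sqrt Real.sqrt_zero
  refine ⟨b, eq_of _ _ fun p => ?_⟩
  have hp := hb p (Quo p) (π p) (norm_π p)
  have hsa : IsSelfAdjoint (π p a) := (h p).isSelfAdjoint
  have h5 : star (cfcₙ Real.sqrt (π p a)) = cfcₙ Real.sqrt (π p a) :=
    cfcₙ_predicate (p := IsSelfAdjoint) Real.sqrt (π p a)
  rw [map_mul, map_star, hp, h5, ← cfcₙ_mul Real.sqrt Real.sqrt (π p a)
    Real.continuous_sqrt.continuousOn Real.sqrt_zero Real.continuous_sqrt.continuousOn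
    Real.sqrt_zero]
  conv_lhs => rw [← cfcₙ_id' ℝ (π p a)]
  refine cfcₙ_congr fun t ht => ?_
  exact (Real.mul_self_sqrt (quasispectrum_nonneg_of_nonneg (π p a) (h p) t ht)).symm

theorem exists_star_mul_self_of_compress {D : Type*} [NonUnitalCStarAlgebra D] (M : D)
    (hsa : IsSelfAdjoint M)
    (h : ∀ N R : D, star N = N → N * M * N = -(star R * R) → R = 0) :
    ∃ m : D, M = star m * m := by
  let _ := CStarAlgebra.spectralOrder D
  have := CStarAlgebra.spectralOrderedRing D
  obtain ⟨N, hN⟩ : ∃ N : D, N = M⁻ := ⟨_, rfl⟩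
  have hN0 : 0 ≤ N := hN ▸ CFC.negPart_nonneg M
  have hNs : star N = N := hN0.isSelfAdjoint
  have e1 : N * M * N = -(N * N * N) := by
    conv_lhs => rw [← CFC.posPart_sub_negPart M hsa, ← hN]
    rw [mul_sub, hN, CFC.negPart_mul_posPart, zero_sub, neg_mul]
  have h3 : 0 ≤ N * N * N := by
    have := star_left_conjugate_nonneg hN0 N
    rwa [hNs] at this
  obtain ⟨R, hR⟩ := CStarAlgebra.nonneg_iff_eq_star_mul_self.1 h3
  have hR0 : R = 0 := h N R hNs (by rw [e1, hR])
  have hNN : N = 0 := by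
    rw [hR0, mul_zero] at hR
    have h4 : star (N * N) * (N * N) = 0 := by
      rw [star_mul, hNs, ← mul_assoc, hR, zero_mul]
    have h5 := CStarRing.star_mul_self_eq_zero_iff _ |>.1 h4
    have h6 : star N * N = 0 := by rw [hNs, h5]
    exact CStarRing.star_mul_self_eq_zero_iff _ |>.1 h6
  have hpos' : 0 ≤ M := by
    rw [← CFC.posPart_sub_negPart M hsa, ← hN, hNN, sub_zero]
    exact CFC.posPart_nonneg M
  exact CStarAlgebra.nonneg_iff_eq_star_mul_self.1 hpos'

/-- A matrix over a C⋆-algebra that is positive as a quadratic form is of the form `m⋆ m`. -/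
theorem exists_matrix_factorization {C : Type*} [NonUnitalCStarAlgebra C] [PartialOrder C]
    [StarOrderedRing C] {n : Type} [Fintype n] (M : n → n → C)
    (hM : ∀ i j, star (M i j) = M j i)
    (hpos : ∀ b : n → C, 0 ≤ ∑ i, ∑ j, star (b i) * M i j * b j) :
    ∃ m : n → n → C, ∀ i j, M i j = ∑ k, star (m k i) * m k j := by
  obtain ⟨M', hM'⟩ : ∃ M' : CStarMatrix n n C, M' = CStarMatrix.ofMatrix (Matrix.of M) := ⟨_, rfl⟩
  have hij : ∀ i j, M' i j = M i j := fun i j => by rw [hM']; rfl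
  have hsa : IsSelfAdjoint M' := by
    ext i j
    rw [CStarMatrix.star_apply, hij, hij, hM]
  obtain ⟨m, hm⟩ := exists_star_mul_self_of_compress M' hsa (fun N R hNs e1 => by
    ext i k
    have d1 : 0 ≤ (N * M' * N) k k := by
      have : (N * M' * N) k k = ∑ i, ∑ j, star (N i k) * M i j * N j k := by
        simp only [CStarMatrix.mul_apply, Finset.sum_mul]
        rw [Finset.sum_comm]
        refine Finset.sum_congr rfl fun i _ => Finset.sum_congr rfl fun j _ => ?_
        rw [hij, ← CStarMatrix.star_apply, hNs]
      rw [this]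
      exact hpos fun i => N i k
    rw [e1] at d1
    have d2 : (-(star R * R)) k k = -∑ i, star (R i k) * R i k := by
      change -((star R * R) k k) = _
      simp only [CStarMatrix.mul_apply, CStarMatrix.star_apply]
    rw [d2, neg_nonneg] at d1
    have d3 : ∀ i ∈ Finset.univ, 0 ≤ star (R i k) * R i k := fun i _ => star_mul_self_nonneg _
    have d4 := (Finset.sum_eq_zero_iff_of_nonneg d3).1 (le_antisymm d1 (Finset.sum_nonneg d3)) i
      (Finset.mem_univ i)
    exact CStarRing.star_mul_self_eq_zero_iff _ |>.1 d4)
  refine ⟨fun i j => m i j, fun i j => ?_⟩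
  rw [← hij, hm]
  simp only [CStarMatrix.mul_apply, CStarMatrix.star_apply]

/-! ### Hilbert modules over locally C⋆-algebras -/

/-- A right `A`-module `E` with a positive (possibly degenerate) `A`-valued inner product, which
is `A`-linear in the second variable. The right action of `a : A` on `x : E` is `x <• a`. -/
class SemiHilbertModule (A E : Type*) [LocallyCStarAlgebra A] [AddCommGroup E] [Module ℂ E]
    [SMul Aᵐᵒᵖ E] extends Inner A E where
  add_rsmul : ∀ (x y : E) (a : A), (x + y) <• a = x <• a + y <• a
  rsmul_add : ∀ (x : E) (a b : A), x <• (a + b) = x <• a + x <• b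
  rsmul_mul : ∀ (x : E) (a b : A), x <• (a * b) = (x <• a) <• b
  smul_rsmul : ∀ (c : ℂ) (x : E) (a : A), (c • x) <• a = c • (x <• a)
  rsmul_smul : ∀ (c : ℂ) (x : E) (a : A), x <• (c • a) = c • (x <• a)
  inner_add_right : ∀ x y z : E, inner x (y + z) = inner x y + inner x z
  inner_smul_right : ∀ (c : ℂ) (x y : E), inner x (c • y) = c • inner x y
  inner_rsmul_right : ∀ (x y : E) (a : A), inner x (y <• a) = inner x y * a
  star_inner : ∀ x y : E, star (inner x y) = inner y x
  inner_self_nonneg : ∀ x : E, ∃ a : A, inner x x = star a * a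

/-- A pre-Hilbert `A`-module. -/
class PreHilbertModule (A E : Type*) [LocallyCStarAlgebra A] [AddCommGroup E] [Module ℂ E]
    [SMul Aᵐᵒᵖ E] extends SemiHilbertModule A E where
  eq_zero_of_inner_self : ∀ x : E, inner x x = 0 → x = 0

section Semi

variable (A)
variable {E : Type*} [AddCommGroup E] [Module ℂ E] [SMul Aᵐᵒᵖ E] [SemiHilbertModule A E]

open SemiHilbertModule

local notation "⟪" x ", " y "⟫" => inner A x y

namespace SemiHilbertModule

theorem inner_add_left (x y z : E) : ⟪x + y, z⟫ = ⟪x, z⟫ + ⟪y, z⟫ := by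
  rw [← star_inner, inner_add_right, star_add, star_inner, star_inner]

theorem inner_smul_left (c : ℂ) (x y : E) : ⟪c • x, y⟫ = star c • ⟪x, y⟫ := by
  rw [← star_inner, inner_smul_right, star_smul, star_inner]

theorem inner_rsmul_left (x y : E) (a : A) : ⟪x <• a, y⟫ = star a * ⟪x, y⟫ := by
  rw [← star_inner, inner_rsmul_right, star_mul, star_inner]

/-- The inner product as a sesquilinear map. -/
def innerₛₗ : E →ₗ⋆[ℂ] E →ₗ[ℂ] A :=
  LinearMap.mk₂'ₛₗ (starRingEnd ℂ) (RingHom.id ℂ) (fun x y => ⟪x, y⟫) (inner_add_left A)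
    (inner_smul_left A) inner_add_right inner_smul_right

theorem innerₛₗ_apply (x y : E) : innerₛₗ A x y = ⟪x, y⟫ := rfl

theorem inner_zero_right (x : E) : ⟪x, 0⟫ = 0 := map_zero (innerₛₗ A x)
theorem inner_zero_left (x : E) : ⟪0, x⟫ = 0 := map_zero ((innerₛₗ A).flip x)
theorem inner_sub_right (x y z : E) : ⟪x, y - z⟫ = ⟪x, y⟫ - ⟪x, z⟫ := map_sub (innerₛₗ A x) y z
theorem inner_sub_left (x y z : E) : ⟪x - y, z⟫ = ⟪x, z⟫ - ⟪y, z⟫ :=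
  map_sub ((innerₛₗ A).flip z) x y
theorem inner_sum_right {ι : Type*} (s : Finset ι) (x : E) (f : ι → E) :
    ⟪x, ∑ i ∈ s, f i⟫ = ∑ i ∈ s, ⟪x, f i⟫ := map_sum (innerₛₗ A x) f s
theorem inner_sum_left {ι : Type*} (s : Finset ι) (x : E) (f : ι → E) :
    ⟪∑ i ∈ s, f i, x⟫ = ∑ i ∈ s, ⟪f i, x⟫ := map_sum ((innerₛₗ A).flip x) f s

variable {A}

theorem π_inner_self_nonneg (p : S A) (x : E) : 0 ≤ π p ⟪x, x⟫ := by
  obtain ⟨a, ha⟩ := inner_self_nonneg (A := A) x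
  rw [ha, map_mul, map_star]
  exact star_mul_self_nonneg _

/-- The Cauchy-Schwarz inequality. -/
theorem cauchy_schwarz (p : S A) (x y : E) : p ⟪x, y⟫ ^ 2 ≤ p ⟪x, x⟫ * p ⟪y, y⟫ := by
  obtain ⟨X, hX⟩ : ∃ X, X = π p ⟪x, x⟫ := ⟨_, rfl⟩
  obtain ⟨Y, hY⟩ : ∃ Y, Y = π p ⟪y, y⟫ := ⟨_, rfl⟩
  obtain ⟨Z, hZ⟩ : ∃ Z, Z = π p ⟪x, y⟫ := ⟨_, rfl⟩
  have hZ' : π p ⟪y, x⟫ = star Z := by rw [hZ, ← map_star, star_inner]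
  have hX0 : 0 ≤ X := hX ▸ π_inner_self_nonneg p x
  have main : ∀ t : ℝ, 0 ≤ 2 * t - t ^ 2 * ‖X‖ → (2 * t - t ^ 2 * ‖X‖) * ‖Z‖ ^ 2 ≤ ‖Y‖ := by
    intro t ht
    have h1 := π_inner_self_nonneg p (y - (t : ℂ) • (x <• ⟪x, y⟫))
    have h2 : ∀ c : ℂ, star c = c → π p ⟪y - c • (x <• ⟪x, y⟫), y - c • (x <• ⟪x, y⟫)⟫ =
        Y - c • (star Z * Z) - c • (star Z * Z) + (c * c) • (star Z * X * Z) := fun c hc => by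
      simp only [inner_sub_left, inner_sub_right, inner_smul_left, inner_smul_right,
        inner_rsmul_left, inner_rsmul_right, map_sub, map_smul, map_mul, map_star, hZ', ← hX,
        ← hY, ← hZ, hc, smul_sub, smul_smul, mul_assoc, sub_mul, smul_mul_assoc]
      abel
    replace h2 : π p ⟪y - (t : ℂ) • (x <• ⟪x, y⟫), y - (t : ℂ) • (x <• ⟪x, y⟫)⟫ =
        Y - (2 * t) • (star Z * Z) + (t ^ 2) • (star Z * X * Z) := by
      rw [h2 _ (Complex.conj_ofReal t), ← Complex.ofReal_mul, Complex.coe_smul, Complex.coe_smul,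
        two_mul, add_smul, sq, sub_sub]
    rw [h2] at h1
    have h3 : star Z * X * Z ≤ ‖X‖ • (star Z * Z) :=
      CStarAlgebra.star_left_conjugate_le_norm_smul (hb := hX0.isSelfAdjoint)
    have h4 : (t ^ 2) • (star Z * X * Z) ≤ (t ^ 2) • (‖X‖ • (star Z * Z)) :=
      smul_le_smul_of_nonneg_left h3 (sq_nonneg t)
    have h5 : (2 * t - t ^ 2 * ‖X‖) • (star Z * Z) ≤ Y := by
      rw [sub_smul, mul_smul (t ^ 2), sub_le_iff_le_add, ← sub_nonneg]
      refine (h1.trans (add_le_add_right h4 _)).trans (le_of_eq ?_)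
      abel
    have h6 := CStarAlgebra.norm_le_norm_of_nonneg_of_le
      (smul_nonneg ht (star_mul_self_nonneg Z)) h5
    rwa [norm_smul, CStarRing.norm_star_mul_self, ← sq, Real.norm_of_nonneg ht] at h6
  simp only [← norm_π, ← hX, ← hY, ← hZ]
  rcases (norm_nonneg X).eq_or_lt with h | h
  · have h1 : ∀ t : ℝ, 0 ≤ t → 2 * t * ‖Z‖ ^ 2 ≤ ‖Y‖ := fun t ht => by
      have := main t (by rw [← h]; linarith)
      rwa [← h, mul_zero, sub_zero] at this
    rw [← h, zero_mul]
    by_contra hne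
    have hz : 0 < ‖Z‖ ^ 2 := not_le.1 hne
    have := h1 (‖Y‖ / ‖Z‖ ^ 2 + 1) (by positivity)
    have e : 2 * (‖Y‖ / ‖Z‖ ^ 2 + 1) * ‖Z‖ ^ 2 = 2 * ‖Y‖ + 2 * ‖Z‖ ^ 2 := by
      rw [mul_assoc, add_mul, div_mul_cancel₀ _ hz.ne', one_mul, mul_add]
    nlinarith [norm_nonneg Y]
  · have := main (1 / ‖X‖) (by field_simp; norm_num)
    have e : 2 * (1 / ‖X‖) - (1 / ‖X‖) ^ 2 * ‖X‖ = 1 / ‖X‖ := by field_simp; norm_num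
    rw [e, one_div, inv_mul_le_iff₀ h] at this
    exact this

end SemiHilbertModule

end Semi

end

section

universe u v

variable {A : Type u} [LocallyCStarAlgebra A]

section Bar

variable {E : Type v} [AddCommGroup E] [Module ℂ E] [SMul Aᵐᵒᵖ E] [SemiHilbertModule A E]

open SemiHilbertModule

local notation "⟪" x ", " y "⟫" => inner A x y

/-- The seminorm `x ↦ √(p ⟪x, x⟫)` on a Hilbert `A`-module, for `p ∈ S(A)`. -/
def bar (p : S A) : Seminorm ℂ E :=
  Seminorm.of (fun x => √(p ⟪x, x⟫))
    (fun x y => by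
      refine Real.sqrt_le_iff.2 ⟨by positivity, ?_⟩
      have h1 : p ⟪x, y⟫ ≤ √(p ⟪x, x⟫) * √(p ⟪y, y⟫) := by
        rw [← Real.sqrt_mul (apply_nonneg p _)]
        exact Real.le_sqrt_of_sq_le (cauchy_schwarz p x y)
      have h2 : p ⟪y, x⟫ = p ⟪x, y⟫ := by rw [← star_inner, p.map_star]
      rw [SemiHilbertModule.inner_add_left, SemiHilbertModule.inner_add_right, SemiHilbertModule.inner_add_right]
      calc p (⟪x, x⟫ + ⟪x, y⟫ + (⟪y, x⟫ + ⟪y, y⟫))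
          ≤ (p ⟪x, x⟫ + p ⟪x, y⟫) + (p ⟪y, x⟫ + p ⟪y, y⟫) :=
            (map_add_le_add p _ _).trans (add_le_add (map_add_le_add p _ _) (map_add_le_add p _ _))
        _ ≤ √(p ⟪x, x⟫) ^ 2 + 2 * (√(p ⟪x, x⟫) * √(p ⟪y, y⟫)) + √(p ⟪y, y⟫) ^ 2 := by
            rw [Real.sq_sqrt (apply_nonneg p _), Real.sq_sqrt (apply_nonneg p _), h2]
            linarith
        _ = _ := by ring)
    (fun c x => by
      rw [SemiHilbertModule.inner_smul_left, SemiHilbertModule.inner_smul_right, map_smul_eq_mul, map_smul_eq_mul, ← mul_assoc,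
        norm_star, Real.sqrt_mul (by positivity), Real.sqrt_mul_self (norm_nonneg c)])

theorem bar_apply (p : S A) (x : E) : bar p x = √(p ⟪x, x⟫) := rfl

theorem bar_sq (p : S A) (x : E) : bar p x ^ 2 = p ⟪x, x⟫ := Real.sq_sqrt (apply_nonneg p _)

theorem le_bar_mul_bar (p : S A) (x y : E) : p ⟪x, y⟫ ≤ bar p x * bar p y := by
  rw [bar_apply, bar_apply, ← Real.sqrt_mul (apply_nonneg p _)]
  exact Real.le_sqrt_of_sq_le (cauchy_schwarz p x y)

theorem bar_rsmul_le (p : S A) (x : E) (a : A) : bar p (x <• a) ≤ bar p x * p a := by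
  refine Real.sqrt_le_iff.2 ⟨mul_nonneg (apply_nonneg _ _) (apply_nonneg _ _), ?_⟩
  rw [inner_rsmul_right, inner_rsmul_left, mul_pow, bar_sq]
  calc p (star a * ⟪x, x⟫ * a) ≤ p (star a) * p ⟪x, x⟫ * p a :=
        (p.mul_le _ _).trans (mul_le_mul_of_nonneg_right (p.mul_le _ _) (apply_nonneg p a))
    _ = _ := by rw [p.map_star]; ring

/-- If all directed seminorms of `x` vanish in `A_p`, then `⟪x, y⟫` vanishes in `A_p`. -/
theorem π_inner_eq_zero {p : S A} {x : E} (hx : bar p x = 0) (y : E) :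
    π p ⟪x, y⟫ = 0 ∧ π p ⟪y, x⟫ = 0 := by
  constructor <;> rw [π_eq_zero] <;> refine le_antisymm ?_ (apply_nonneg p _)
  · simpa [hx] using le_bar_mul_bar p x y
  · simpa [hx] using le_bar_mul_bar p y x

/-- The Gram matrix of a finite family in a Hilbert module is positive in `M_n(A_p)`. -/
theorem exists_gram_factorization (p : S A) {n : Type} [Fintype n] (x : n → E) :
    ∃ m : n → n → A, ∀ i j, π p ⟪x i, x j⟫ = π p (∑ k, star (m k i) * m k j) := by
  obtain ⟨m, hm⟩ := exists_matrix_factorization (fun i j => π p ⟪x i, x j⟫)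
    (fun i j => by rw [← map_star, star_inner]) (fun b => by
      choose a ha using fun i => π_surjective p (b i)
      have : ∑ i, ∑ j, star (b i) * π p ⟪x i, x j⟫ * b j =
          π p ⟪∑ i, x i <• a i, ∑ j, x j <• a j⟫ := by
        simp only [inner_sum_left, inner_sum_right, inner_rsmul_left, inner_rsmul_right, map_sum,
          map_mul, map_star, ha]
        simp only [Finset.sum_mul, mul_assoc]
        exact Finset.sum_comm
      rw [this]
      exact π_inner_self_nonneg p _)
  choose m' hm' using fun i j => π_surjective p (m i j)
  exact ⟨m', fun i j => by simp only [map_sum, map_mul, map_star, hm', hm]⟩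

variable (A E)

/-- The uniform structure of a Hilbert `A`-module: the one defined by the family of seminorms
`bar p`, `p ∈ S(A)`. -/
@[reducible]
def hilbertUniformSpace : UniformSpace E :=
  ⨅ p : S A, (bar (E := E) p).toSeminormedAddCommGroup.toUniformSpace

/-- The topology of a Hilbert `A`-module. -/
@[reducible]
def hilbertTopology : TopologicalSpace E := (hilbertUniformSpace A E).toTopologicalSpace

/-- A Hilbert `A`-module is full if the inner products span a dense subspace of `A`. -/
def IsFull : Prop :=
  Dense (Submodule.span ℂ (Set.range fun x : E × E => inner A x.1 x.2) : Set A)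

end Bar

/-- A Hilbert module over the locally C⋆-algebra `A`: a pre-Hilbert `A`-module that is complete
with respect to the family of seminorms `bar p`, `p ∈ S(A)`. -/
class HilbertModule (A E : Type*) [LocallyCStarAlgebra A] [AddCommGroup E] [Module ℂ E]
    [SMul Aᵐᵒᵖ E] extends PreHilbertModule A E where
  complete : @CompleteSpace E (hilbertUniformSpace A E)

/-! ### The quotient modules `E_p` -/

/-- A copy of `E` carrying the seminorm `bar p` as its only topological structure. -/
def WithBar (_p : S A) (E : Type v) : Type v := E

section Quot

open SemiHilbertModule

variable (p : S A) (E : Type v) [AddCommGroup E] [Module ℂ E] [SMul Aᵐᵒᵖ E] [SemiHilbertModule A E]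

local notation "⟪" x ", " y "⟫" => inner A x y

instance : AddCommGroup (WithBar p E) := inferInstanceAs (AddCommGroup E)
instance : Module ℂ (WithBar p E) := inferInstanceAs (Module ℂ E)

instance : SeminormedAddCommGroup (WithBar p E) where
  __ := (inferInstance : AddCommGroup (WithBar p E))
  __ := @AddGroupSeminorm.toSeminormedAddCommGroup (WithBar p E) _
    (bar (E := E) p).toAddGroupSeminorm

instance : NormedSpace ℂ (WithBar p E) where
  __ := (inferInstance : Module ℂ (WithBar p E))
  norm_smul_le c x := (map_smul_eq_mul (bar (E := E) p) c x).le

/-- `E_p = E / N_p^E`, `N_p^E = {x | bar p x = 0}`. -/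
def ModQuo : Type v := SeparationQuotient (WithBar p E)

instance ModQuo.instNormedAddCommGroup : NormedAddCommGroup (ModQuo p E) :=
  inferInstanceAs (NormedAddCommGroup (SeparationQuotient (WithBar p E)))

instance ModQuo.instNormedSpace : NormedSpace ℂ (ModQuo p E) :=
  inferInstanceAs (NormedSpace ℂ (SeparationQuotient (WithBar p E)))

/-- The canonical map `σ_p : E → E_p`. -/
def σ : E →ₗ[ℂ] ModQuo p E where
  toFun x := SeparationQuotient.mk (X := WithBar p E) x
  map_add' _ _ := rfl
  map_smul' _ _ := rfl

variable {E}

theorem σ_surjective : Function.Surjective (σ p E) :=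
  SeparationQuotient.surjective_mk (X := WithBar p E)

theorem norm_σ (x : E) : ‖σ p E x‖ = bar p x := rfl

variable {p}

theorem σ_eq_zero {x : E} : σ p E x = 0 ↔ bar p x = 0 := by rw [← norm_σ, norm_eq_zero]

theorem bar_sub_eq_zero {x y : E} (h : σ p E x = σ p E y) : bar p (x - y) = 0 := by
  rwa [← sub_eq_zero, ← map_sub, σ_eq_zero] at h

theorem S.sub_eq_zero {a b : A} (h : π p a = π p b) : p (a - b) = 0 := by
  rwa [← _root_.sub_eq_zero, ← map_sub, π_eq_zero] at h

theorem ModQuo.ind {P : ModQuo p E → Prop} (h : ∀ x : E, P (σ p E x)) (x : ModQuo p E) : P x := by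
  obtain ⟨x, rfl⟩ := σ_surjective p x
  exact h x

theorem Quo.ind {P : Quo p → Prop} (h : ∀ a : A, P (π p a)) (a : Quo p) : P a := by
  obtain ⟨a, rfl⟩ := π_surjective p a
  exact h a

theorem sub_rsmul (x y : E) (a : A) : (x - y) <• a = x <• a - y <• a := by
  rw [eq_sub_iff_add_eq, ← add_rsmul, sub_add_cancel]

theorem rsmul_sub (x : E) (a b : A) : x <• (a - b) = x <• a - x <• b := by
  rw [eq_sub_iff_add_eq, ← rsmul_add, sub_add_cancel]

theorem σ_rsmul_congr {x y : E} {a b : A} (hx : σ p E x = σ p E y) (ha : π p a = π p b) :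
    σ p E (x <• a) = σ p E (y <• b) := by
  have e : x <• a - y <• b = (x - y) <• a + y <• (a - b) := by
    rw [sub_rsmul, rsmul_sub]
    abel
  rw [← sub_eq_zero, ← map_sub, e, map_add]
  have k1 : bar p ((x - y) <• a) = 0 := le_antisymm
    ((bar_rsmul_le p _ _).trans (by rw [bar_sub_eq_zero hx, zero_mul])) (apply_nonneg _ _)
  have k2 : bar p (y <• (a - b)) = 0 := le_antisymm
    ((bar_rsmul_le p _ _).trans (by rw [S.sub_eq_zero ha, mul_zero])) (apply_nonneg _ _)
  rw [σ_eq_zero.2 k1, σ_eq_zero.2 k2, add_zero]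

theorem π_inner_congr {x y x' y' : E} (hx : σ p E x = σ p E x') (hy : σ p E y = σ p E y') :
    π p ⟪x, y⟫ = π p ⟪x', y'⟫ := by
  have e : ⟪x, y⟫ - ⟪x', y'⟫ = ⟪x - x', y⟫ + ⟪x', y - y'⟫ := by
    rw [SemiHilbertModule.inner_sub_left, SemiHilbertModule.inner_sub_right]
    abel
  rw [← sub_eq_zero, ← map_sub, e, map_add, (π_inner_eq_zero (bar_sub_eq_zero hx) y).1,
    (π_inner_eq_zero (bar_sub_eq_zero hy) x').2, add_zero]

variable (p E)

/-- `σ_p x <• π_p a = σ_p (x <• a)`. -/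
instance ModQuo.instSMul : SMul (Quo p)ᵐᵒᵖ (ModQuo p E) where
  smul a x := SeparationQuotient.lift₂ (X := WithBar p E) (Y := WithS p)
    (fun (x : E) (a : A) => σ p E (x <• a)) (fun _ _ _ _ hx ha =>
      σ_rsmul_congr (SeparationQuotient.mk_eq_mk.2 hx) (SeparationQuotient.mk_eq_mk.2 ha)) x a.unop

variable {E}

theorem σ_rsmul (x : E) (a : A) : σ p E (x <• a) = σ p E x <• π p a := rfl

/-- `⟪σ_p x, σ_p y⟫ = π_p ⟪x, y⟫`. -/
instance ModQuo.instPreHilbertModule : PreHilbertModule (Quo p) (ModQuo p E) where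
  inner := SeparationQuotient.lift₂ (X := WithBar p E) (Y := WithBar p E)
    (fun x y : E => π p ⟪x, y⟫) (fun _ _ _ _ hx hy =>
      π_inner_congr (SeparationQuotient.mk_eq_mk.2 hx) (SeparationQuotient.mk_eq_mk.2 hy))
  add_rsmul := ModQuo.ind fun x => ModQuo.ind fun y => Quo.ind fun a =>
    congrArg (σ p E) (add_rsmul x y a)
  rsmul_add := ModQuo.ind fun x => Quo.ind fun a => Quo.ind fun b =>
    congrArg (σ p E) (rsmul_add x a b)
  rsmul_mul := ModQuo.ind fun x => Quo.ind fun a => Quo.ind fun b =>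
    congrArg (σ p E) (rsmul_mul x a b)
  smul_rsmul c := ModQuo.ind fun x => Quo.ind fun a => congrArg (σ p E) (smul_rsmul c x a)
  rsmul_smul c := ModQuo.ind fun x => Quo.ind fun a => congrArg (σ p E) (rsmul_smul c x a)
  inner_add_right := ModQuo.ind fun x => ModQuo.ind fun y => ModQuo.ind fun z =>
    congrArg (π p) (SemiHilbertModule.inner_add_right (A := A) x y z)
  inner_smul_right c := ModQuo.ind fun x => ModQuo.ind fun y =>
    congrArg (π p) (SemiHilbertModule.inner_smul_right (A := A) c x y)
  inner_rsmul_right := ModQuo.ind fun x => ModQuo.ind fun y => Quo.ind fun a =>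
    congrArg (π p) (inner_rsmul_right (A := A) x y a)
  star_inner := ModQuo.ind fun x => ModQuo.ind fun y => congrArg (π p) (star_inner (A := A) x y)
  inner_self_nonneg := ModQuo.ind fun x => by
    obtain ⟨a, ha⟩ := inner_self_nonneg (A := A) x
    exact ⟨π p a, congrArg (π p) ha⟩
  eq_zero_of_inner_self := ModQuo.ind fun x hx => by
    have h : p ⟪x, x⟫ = 0 := π_eq_zero.1 hx
    rw [σ_eq_zero, bar_apply, h, Real.sqrt_zero]

theorem inner_σ (x y : E) : inner (Quo p) (σ p E x) (σ p E y) = π p ⟪x, y⟫ := rfl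

end Quot

end

section

universe u v

variable {B : Type u} [LocallyCStarAlgebra B]

/-! ### Bounded adjointable module maps -/

section Adjointable

variable {E : Type v} [AddCommGroup E] [Module ℂ E] [SMul Bᵐᵒᵖ E] [PreHilbertModule B E]

open SemiHilbertModule

local notation "⟪" x ", " y "⟫" => inner B x y

variable (B) in
/-- `T` is a bounded adjointable `B`-module map. -/
structure IsBoundedAdjointable (T : E →ₗ[ℂ] E) : Prop where
  map_rsmul : ∀ (x : E) (b : B), T (x <• b) = T x <• b
  bounded : ∀ q : S B, ∃ k : ℝ, 0 ≤ k ∧ ∀ x, bar q (T x) ≤ k * bar q x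
  adjointable : ∃ T' : E → E, ∀ x y, ⟪T x, y⟫ = ⟪x, T' y⟫

variable (B) in
theorem ext_inner {x y : E} (h : ∀ z, ⟪z, x⟫ = ⟪z, y⟫) : x = y := by
  rw [← sub_eq_zero]
  refine PreHilbertModule.eq_zero_of_inner_self (A := B) _ ?_
  rw [SemiHilbertModule.inner_sub_right, h, sub_self]

namespace IsBoundedAdjointable

variable {T R : E →ₗ[ℂ] E}

theorem exists_adjoint (hT : IsBoundedAdjointable B T) :
    ∃ T' : E →ₗ[ℂ] E, IsBoundedAdjointable B T' ∧ (∀ x y, ⟪T x, y⟫ = ⟪x, T' y⟫) := by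
  obtain ⟨T', h⟩ := hT.adjointable
  refine ⟨⟨⟨T', fun x y => ext_inner B fun z => ?_⟩, fun c x => ext_inner B fun z => ?_⟩,
    ⟨fun x b => ext_inner B fun z => ?_, fun q => ?_, T, fun x y => ?_⟩, h⟩
  · rw [SemiHilbertModule.inner_add_right, ← h, ← h, ← h, SemiHilbertModule.inner_add_right]
  · simp only [RingHom.id_apply]
    rw [SemiHilbertModule.inner_smul_right, ← h, ← h, SemiHilbertModule.inner_smul_right]
  · change ⟪z, T' (x <• b)⟫ = ⟪z, T' x <• b⟫
    rw [inner_rsmul_right, ← h, ← h, inner_rsmul_right]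
  · obtain ⟨k, hk, hb⟩ := hT.bounded q
    refine ⟨k, hk, fun x => ?_⟩
    change bar q (T' x) ≤ k * bar q x
    have h1 : bar q (T' x) ^ 2 ≤ (k * bar q (T' x)) * bar q x := by
      rw [bar_sq, ← h]
      exact (le_bar_mul_bar q _ _).trans (mul_le_mul_of_nonneg_right (hb _) (apply_nonneg _ _))
    rcases (apply_nonneg (bar (E := E) q) (T' x)).eq_or_lt with h0 | h0
    · rw [← h0]
      exact mul_nonneg hk (apply_nonneg _ _)
    · refine le_of_mul_le_mul_right ?_ h0
      calc _ = bar q (T' x) ^ 2 := (sq _).symm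
        _ ≤ _ := h1
        _ = _ := by ring
  · change ⟪T' x, y⟫ = _
    rw [← star_inner, ← h, star_inner]

theorem add (hT : IsBoundedAdjointable B T) (hR : IsBoundedAdjointable B R) :
    IsBoundedAdjointable B (T + R) where
  map_rsmul x b := by
    rw [LinearMap.add_apply, hT.map_rsmul, hR.map_rsmul, LinearMap.add_apply, add_rsmul]
  bounded q := by
    obtain ⟨k, hk, h⟩ := hT.bounded q
    obtain ⟨l, hl, h'⟩ := hR.bounded q
    refine ⟨k + l, add_nonneg hk hl, fun x => ?_⟩
    rw [add_mul]
    exact (map_add_le_add _ _ _).trans (add_le_add (h x) (h' x))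
  adjointable := by
    obtain ⟨T', h⟩ := hT.adjointable
    obtain ⟨R', h'⟩ := hR.adjointable
    exact ⟨fun y => T' y + R' y, fun x y => by
      rw [LinearMap.add_apply, SemiHilbertModule.inner_add_left,
        SemiHilbertModule.inner_add_right, h, h']⟩

theorem mul (hT : IsBoundedAdjointable B T) (hR : IsBoundedAdjointable B R) :
    IsBoundedAdjointable B (T ∘ₗ R) where
  map_rsmul x b := by
    rw [LinearMap.comp_apply, hR.map_rsmul, hT.map_rsmul, LinearMap.comp_apply]
  bounded q := by
    obtain ⟨k, hk, h⟩ := hT.bounded q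
    obtain ⟨l, hl, h'⟩ := hR.bounded q
    refine ⟨k * l, mul_nonneg hk hl, fun x => ?_⟩
    rw [mul_assoc]
    exact (h _).trans (mul_le_mul_of_nonneg_left (h' x) hk)
  adjointable := by
    obtain ⟨T', h⟩ := hT.adjointable
    obtain ⟨R', h'⟩ := hR.adjointable
    exact ⟨fun y => R' (T' y), fun x y => by rw [LinearMap.comp_apply, h, h']⟩

theorem smul_id (c : ℂ) : IsBoundedAdjointable B (c • LinearMap.id : E →ₗ[ℂ] E) where
  map_rsmul x b := (smul_rsmul c x b).symm
  bounded q := ⟨‖c‖, norm_nonneg c, fun x => (map_smul_eq_mul (bar (E := E) q) c x).le⟩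
  adjointable := ⟨fun y => star c • y, fun x y => by
    rw [SemiHilbertModule.inner_smul_right]
    exact SemiHilbertModule.inner_smul_left B c x y⟩

end IsBoundedAdjointable

variable (B E)

/-- The algebra of bounded adjointable `B`-module maps on `E`. -/
def adjointableSubalgebra : Subalgebra ℂ (Module.End ℂ E) where
  carrier := {T | IsBoundedAdjointable B T}
  mul_mem' hT hR := hT.mul hR
  add_mem' hT hR := hT.add hR
  algebraMap_mem' c := IsBoundedAdjointable.smul_id c

/-- `L_B(E)`: the algebra of bounded adjointable `B`-module maps on `E`. -/
def L : Type v := adjointableSubalgebra B E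

namespace L

instance : Ring (L B E) := inferInstanceAs (Ring (adjointableSubalgebra B E))
instance : Algebra ℂ (L B E) := inferInstanceAs (Algebra ℂ (adjointableSubalgebra B E))

variable {B E}

/-- The underlying linear map. -/
def lin (T : L B E) : E →ₗ[ℂ] E := Subtype.val T

instance : CoeFun (L B E) fun _ => E → E where
  coe T := T.lin

theorem prop (T : L B E) : IsBoundedAdjointable B T.lin := Subtype.property T

@[ext]
theorem ext {T R : L B E} (h : ∀ x, T x = R x) : T = R := Subtype.ext (LinearMap.ext h)

/-- Bundling a bounded adjointable map. -/
def mk (T : E →ₗ[ℂ] E) (hT : IsBoundedAdjointable B T) : L B E := Subtype.mk T hT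

theorem mk_apply (T : E →ₗ[ℂ] E) (hT : IsBoundedAdjointable B T) (x : E) : mk T hT x = T x := rfl
theorem add_apply (T R : L B E) (x : E) : (T + R) x = T x + R x := rfl
theorem mul_apply (T R : L B E) (x : E) : (T * R) x = T (R x) := rfl
theorem smul_apply (c : ℂ) (T : L B E) (x : E) : (c • T) x = c • T x := rfl
theorem zero_apply (x : E) : (0 : L B E) x = 0 := rfl
theorem one_apply (x : E) : (1 : L B E) x = x := rfl

/-- The adjoint: `⟪T x, y⟫ = ⟪x, T⋆ y⟫`. -/
instance : Star (L B E) where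
  star T := mk T.prop.exists_adjoint.choose T.prop.exists_adjoint.choose_spec.1

theorem inner_left (T : L B E) (x y : E) : ⟪T x, y⟫ = ⟪x, star T y⟫ :=
  T.prop.exists_adjoint.choose_spec.2 x y

theorem inner_right (T : L B E) (x y : E) : ⟪x, T y⟫ = ⟪star T x, y⟫ := by
  rw [← star_inner, inner_left, star_inner]

theorem eq_star_of_inner {T R : L B E} (h : ∀ x y, ⟪T x, y⟫ = ⟪x, R y⟫) : R = star T :=
  ext fun y => ext_inner B fun x => by rw [← h, inner_left]

instance : StarRing (L B E) where
  star_involutive T := (eq_star_of_inner fun x y => (inner_right T x y).symm).symm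
  star_mul T R := (eq_star_of_inner fun x y => by
    rw [mul_apply, mul_apply, inner_left, inner_left]).symm
  star_add T R := (eq_star_of_inner fun x y => by
    rw [add_apply, add_apply, SemiHilbertModule.inner_add_left,
      SemiHilbertModule.inner_add_right, inner_left, inner_left]).symm

instance : StarModule ℂ (L B E) where
  star_smul c T := (eq_star_of_inner fun x y => by
    rw [smul_apply, smul_apply, SemiHilbertModule.inner_smul_left,
      SemiHilbertModule.inner_smul_right, inner_left]).symm

end L

end Adjointable

/-! ### The maps `(π_q)_* : L_B(E) → L_{B_q}(E_q)` and the topology of `L_B(E)` -/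

section Push

/-- The pullback to `B` of a continuous C⋆-seminorm on `B_q`. -/
def pullS {q : S B} (r : S (Quo q)) : S B :=
  ⟨⟨r.1.toSeminorm.comp (π q : B →ₗ[ℂ] Quo q),
    fun a b => (congrArg r (map_mul (π q) a b)).trans_le (r.mul_le _ _), fun a => by
      exact (congrArg r ((map_mul (π q) _ _).trans (by rw [map_star]))).trans
        (r.star_mul_self (π q a))⟩, r.continuous.comp (π_continuous q)⟩

theorem pullS_apply {q : S B} (r : S (Quo q)) (b : B) : pullS r b = r (π q b) := rfl

variable {E : Type v} [AddCommGroup E] [Module ℂ E] [SMul Bᵐᵒᵖ E] [PreHilbertModule B E]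

theorem bar_σ {q : S B} (r : S (Quo q)) (x : E) : bar r (σ q E x) = bar (pullS r) x := rfl

/-- The map induced on `E_q`. -/
def pushLin (q : S B) (T : L B E) : ModQuo q E →ₗ[ℂ] ModQuo q E where
  toFun := SeparationQuotient.lift (X := WithBar q E) (fun x : E => σ q E (T x)) (by
    intro (x : E) (y : E) h
    obtain ⟨k, -, hk⟩ := T.prop.bounded q
    have h1 : bar q (x - y) = 0 := bar_sub_eq_zero (SeparationQuotient.mk_eq_mk.2 h)
    have h2 : bar q (T.lin (x - y)) = 0 :=
      le_antisymm ((hk _).trans (by rw [h1, mul_zero])) (apply_nonneg _ _)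
    rw [← sub_eq_zero, ← map_sub, σ_eq_zero, ← map_sub, h2])
  map_add' := ModQuo.ind fun x => ModQuo.ind fun y => by
    change σ q E (T.lin (x + y)) = σ q E (T.lin x) + σ q E (T.lin y)
    rw [map_add, map_add]
  map_smul' c := ModQuo.ind fun x => by
    change σ q E (T.lin (c • x)) = c • σ q E (T.lin x)
    rw [map_smul, map_smul]

theorem pushLin_σ (q : S B) (T : L B E) (x : E) : pushLin q T (σ q E x) = σ q E (T x) := rfl

/-- `(π_q)_* : L_B(E) → L_{B_q}(E_q)`, `(π_q)_*(T)(σ_q x) = σ_q (T x)`. -/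
def pushforward (q : S B) (T : L B E) : L (Quo q) (ModQuo q E) :=
  L.mk (pushLin q T)
    { map_rsmul := ModQuo.ind fun x => Quo.ind fun b => congrArg (σ q E) (T.prop.map_rsmul x b)
      bounded := fun r => by
        obtain ⟨k, h0, hk⟩ := T.prop.bounded (pullS r)
        exact ⟨k, h0, ModQuo.ind fun x => hk x⟩
      adjointable := ⟨pushLin q (star T), ModQuo.ind fun x => ModQuo.ind fun y =>
        congrArg (π q) (T.inner_left x y)⟩ }

theorem pushforward_σ (q : S B) (T : L B E) (x : E) :
    pushforward q T (σ q E x) = σ q E (T x) := rfl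

/-- `(π_q)_*(T)` as a bounded operator of the normed space `E_q`. -/
def pushCLM (q : S B) : L B E →ₗ[ℂ] (ModQuo q E →L[ℂ] ModQuo q E) where
  toFun T := (pushLin q T).mkContinuousOfExistsBound (by
    obtain ⟨k, -, hk⟩ := T.prop.bounded q
    exact ⟨k, ModQuo.ind hk⟩)
  map_add' T R := ContinuousLinearMap.ext <| ModQuo.ind fun x => map_add (σ q E) (T x) (R x)
  map_smul' c T := ContinuousLinearMap.ext <| ModQuo.ind fun x => map_smul (σ q E) c (T x)

theorem pushCLM_apply (q : S B) (T : L B E) (x : ModQuo q E) :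
    pushCLM q T x = pushforward q T x := rfl

/-- The seminorm `q̃(T) = ‖(π_q)_*(T)‖` on `L_B(E)`. -/
def tilde (q : S B) : Seminorm ℂ (L B E) := (normSeminorm ℂ _).comp (pushCLM q)

theorem tilde_apply (q : S B) (T : L B E) : tilde q T = ‖pushCLM q T‖ := rfl

theorem bar_le_tilde (q : S B) (T : L B E) (x : E) : bar q (T x) ≤ tilde q T * bar q x :=
  (pushCLM q T).le_opNorm (σ q E x)

/-- The topology of `L_B(E)`: the one defined by the seminorms `q̃`, `q ∈ S(B)`. -/
instance L.instTopologicalSpace : TopologicalSpace (L B E) :=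
  ⨅ q : S B, (tilde (E := E) q).toSeminormedAddCommGroup.toUniformSpace.toTopologicalSpace

theorem tilde_continuous (q : S B) : Continuous (tilde (E := E) q) :=
  continuous_iInf_dom (i := q) (@continuous_norm (L B E)
    (tilde (E := E) q).toSeminormedAddCommGroup.toSeminormedAddGroup)

end Push

section Morphism

variable {A : Type*} [LocallyCStarAlgebra A]
  {E : Type v} [AddCommGroup E] [Module ℂ E] [SMul Bᵐᵒᵖ E] [PreHilbertModule B E]

/-- A ⋆-morphism `Ψ : A → L_B(E)` is non-degenerate if the linear span of `Ψ(A) E` is dense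
in `E`. -/
def IsNondegenerateAction (Ψ : A →⋆ₙₐ[ℂ] L B E) : Prop :=
  @Dense E (hilbertTopology B E)
    (Submodule.span ℂ (Set.range fun z : A × E => Ψ z.1 z.2) : Set E)

/-- A continuous function dominated near zero by a continuous seminorm. -/
theorem exists_bound_of_continuous {F : Type*} [AddCommGroup F] [Module ℂ F] (f : A →ₗ[ℂ] F)
    (r : Seminorm ℂ F) (hf : Continuous fun a => r (f a)) :
    ∃ (p : S A) (C : ℝ), 0 ≤ C ∧ ∀ a, r (f a) ≤ C * p a := by
  have h1 : Tendsto (fun a => r (f a)) (𝓝 0) (𝓝 0) := by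
    have := hf.tendsto 0
    simpa using this
  obtain ⟨⟨p, ε⟩, hε, h⟩ := (nhds_zero_basis (A := A)).mem_iff.1
    (h1.eventually_lt_const one_pos)
  replace hε : 0 < ε := hε
  have h : ∀ a, p a < ε → r (f a) < 1 := h
  refine ⟨p, 2 / ε, by positivity, fun a => ?_⟩
  have key : ∀ t : ℝ, 0 < t → t * p a < ε → t * r (f a) < 1 := fun t ht hlt => by
    have := h ((t : ℂ) • a) (by
      rw [map_smul_eq_mul, Complex.norm_real, Real.norm_of_nonneg ht.le]; exact hlt)
    rwa [map_smul, map_smul_eq_mul, Complex.norm_real, Real.norm_of_nonneg ht.le] at this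
  rcases (apply_nonneg p a).eq_or_lt with h0 | h0
  · rw [← h0, mul_zero]
    by_contra hne
    have hr : 0 < r (f a) := not_le.1 hne
    have := key (r (f a))⁻¹ (inv_pos.2 hr) (by rw [← h0, mul_zero]; exact hε)
    rw [inv_mul_cancel₀ hr.ne'] at this
    exact lt_irrefl _ this
  · have := key (ε / (2 * p a)) (by positivity) (by field_simp; norm_num)
    rw [div_mul_eq_mul_div, div_lt_one (by positivity)] at this
    rw [div_mul_eq_mul_div, le_div_iff₀ hε]
    linarith

end Morphism

end

section

universe u v

/-! ### Representations -/

section Representations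

open ContinuousLinearMap (adjoint)

/-- A representation `Φ : V → B(H, K)` of the Hilbert `A`-module `V`: a `φ`-morphism, that is
`Φ(x)⋆ Φ(y) = φ(⟪x, y⟫)`, for a representation (continuous ⋆-morphism) `φ : A → B(H)`. -/
structure HilbertRep (A : Type*) [LocallyCStarAlgebra A] (V : Type*) [AddCommGroup V] [Module ℂ V]
    [SMul Aᵐᵒᵖ V] [SemiHilbertModule A V]
    (H : Type*) [NormedAddCommGroup H] [InnerProductSpace ℂ H] [CompleteSpace H]
    (K : Type*) [NormedAddCommGroup K] [InnerProductSpace ℂ K] [CompleteSpace K] where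
  φ : A →⋆ₙₐ[ℂ] (H →L[ℂ] H)
  continuous_φ : Continuous φ
  toFun : V → (H →L[ℂ] K)
  adjoint_comp : ∀ x y : V, adjoint (toFun x) ∘L toFun y = φ (inner A x y)

variable {A : Type u} [LocallyCStarAlgebra A] {V : Type v} [AddCommGroup V] [Module ℂ V]
  [SMul Aᵐᵒᵖ V] [SemiHilbertModule A V]
  {H : Type*} [NormedAddCommGroup H] [InnerProductSpace ℂ H] [CompleteSpace H]
  {K : Type*} [NormedAddCommGroup K] [InnerProductSpace ℂ K] [CompleteSpace K]
  {H' : Type*} [NormedAddCommGroup H'] [InnerProductSpace ℂ H'] [CompleteSpace H']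
  {K' : Type*} [NormedAddCommGroup K'] [InnerProductSpace ℂ K'] [CompleteSpace K']

/-- A representation of an algebra on `H` is non-degenerate if the span of `φ(A) H` is dense. -/
def IsNondegenerateRep (φ : A →⋆ₙₐ[ℂ] (H →L[ℂ] H)) : Prop :=
  Dense (Submodule.span ℂ (Set.range fun z : A × H => φ z.1 z.2) : Set H)

namespace HilbertRep

instance : CoeFun (HilbertRep A V H K) fun _ => V → (H →L[ℂ] K) where
  coe Φ := Φ.toFun

/-- A representation is non-degenerate if the span of `Φ(V) H` is dense in `K` and the span of
`Φ(V)⋆ K` is dense in `H`. -/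
structure Nondegenerate (Φ : HilbertRep A V H K) : Prop where
  dense_range : Dense (Submodule.span ℂ (Set.range fun z : V × H => Φ z.1 z.2) : Set K)
  dense_range_adjoint :
    Dense (Submodule.span ℂ (Set.range fun z : V × K => adjoint (Φ z.1) z.2) : Set H)

/-- Unitary equivalence of representations of `V`. -/
def UnitarilyEquivalent (Φ₁ : HilbertRep A V H K) (Φ₂ : HilbertRep A V H' K') : Prop :=
  ∃ (U₁ : H ≃ₗᵢ[ℂ] H') (U₂ : K ≃ₗᵢ[ℂ] K'), ∀ (v : V) (h : H), U₂ (Φ₁ v h) = Φ₂ v (U₁ h)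

/-- The representation `Φ ∘ σ_p` of `V`, for a representation `Φ` of `V_p`. -/
def compσ {p : S A} (Φ : HilbertRep (Quo p) (ModQuo p V) H K) : HilbertRep A V H K where
  φ := Φ.φ.comp (π p)
  continuous_φ := Φ.continuous_φ.comp (π_continuous p)
  toFun v := Φ (σ p V v)
  adjoint_comp x y := Φ.adjoint_comp (σ p V x) (σ p V y)

theorem inner_apply (Φ : HilbertRep A V H K) (x y : V) (h k : H) :
    inner ℂ (Φ x h) (Φ y k) = inner ℂ h (Φ.φ (inner A x y) k) := by
  rw [← Φ.adjoint_comp, ContinuousLinearMap.comp_apply, ContinuousLinearMap.adjoint_inner_right]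

theorem eq_of_φ_eq_zero (Φ : HilbertRep A V H K) (x y : V) (h : Φ.φ (inner A (x - y) (x - y)) = 0) :
    Φ x = Φ y := by
  ext k
  rw [← sub_eq_zero, ← inner_self_eq_zero (𝕜 := ℂ)]
  simp only [_root_.inner_sub_left, _root_.inner_sub_right, inner_apply]
  rw [SemiHilbertModule.inner_sub_right, SemiHilbertModule.inner_sub_left,
    SemiHilbertModule.inner_sub_left, map_sub, map_sub, map_sub] at h
  have := congrArg (fun T : H →L[ℂ] H => inner ℂ k (T k)) h
  simp only [_root_.sub_apply, _root_.zero_apply, _root_.inner_sub_right,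
    _root_.inner_zero_right] at this
  linear_combination this

/-- The representation `Φ_q` of `V_q` associated to `Φ`, `Φ_q (σ_q v) = Φ v`, for a
representation `φ_q` of `A_q` associated to `φ`, that is `φ_q ∘ π_q = φ`. -/
def assoc (Φ : HilbertRep A V H K) (q : S A) (φq : Quo q →⋆ₙₐ[ℂ] (H →L[ℂ] H))
    (hφq : ∀ a, φq (π q a) = Φ.φ a) : HilbertRep (Quo q) (ModQuo q V) H K where
  φ := φq
  continuous_φ := by
    have h : ∀ a, ‖φq a‖ ≤ ‖a‖ := NonUnitalStarAlgHom.norm_apply_le φq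
    exact AddMonoidHomClass.continuous_of_bound φq 1 fun a => by rw [one_mul]; exact h a
  toFun := SeparationQuotient.lift (X := WithBar q V) (fun v : V => Φ v) (by
    intro (x : V) (y : V) h
    have h1 : bar q (x - y) = 0 := bar_sub_eq_zero (SeparationQuotient.mk_eq_mk.2 h)
    refine Φ.eq_of_φ_eq_zero x y ?_
    rw [← hφq, (π_inner_eq_zero h1 _).1, map_zero])
  adjoint_comp := ModQuo.ind fun x => ModQuo.ind fun y =>
    (Φ.adjoint_comp x y).trans (hφq _).symm

theorem assoc_σ (Φ : HilbertRep A V H K) (q : S A) (φq : Quo q →⋆ₙₐ[ℂ] (H →L[ℂ] H))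
    (hφq : ∀ a, φq (π q a) = Φ.φ a) (v : V) : Φ.assoc q φq hφq (σ q V v) = Φ v := rfl

end HilbertRep

end Representations

end

section

universe u v

/-! ### The Hilbert space `_E H` -/

theorem exists_fin_sum_tmul {M N : Type*} [AddCommGroup M] [Module ℂ M] [AddCommGroup N]
    [Module ℂ N] (ξ : M ⊗[ℂ] N) :
    ∃ (n : ℕ) (x : Fin n → M) (y : Fin n → N), ξ = ∑ i, x i ⊗ₜ[ℂ] y i := by
  obtain ⟨s, hs⟩ := TensorProduct.exists_finset ξ
  refine ⟨s.card, fun i => (s.equivFin.symm i).1.1, fun i => (s.equivFin.symm i).1.2, ?_⟩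
  rw [hs, ← Finset.sum_coe_sort]
  exact (Equiv.sum_comp s.equivFin.symm fun z : s => z.1.1 ⊗ₜ[ℂ] z.1.2).symm

section EH

variable {B : Type u} [LocallyCStarAlgebra B]
  {H : Type*} [NormedAddCommGroup H] [InnerProductSpace ℂ H] [CompleteSpace H]
  (E : Type v) [AddCommGroup E] [Module ℂ E] [SMul Bᵐᵒᵖ E] [SemiHilbertModule B E]
  (φ : B →⋆ₙₐ[ℂ] (H →L[ℂ] H))

theorem exists_bound_rep (hφ : Continuous φ) :
    ∃ (p : S B) (C : ℝ), 0 ≤ C ∧ ∀ b, ‖φ b‖ ≤ C * p b :=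
  exists_bound_of_continuous (φ : B →ₗ[ℂ] (H →L[ℂ] H)) (normSeminorm ℂ _)
    (continuous_norm.comp hφ)

/-- The sesquilinear form on `E ⊗ H` with `⟨x ⊗ h, y ⊗ k⟩ = ⟨h, φ(⟪x, y⟫) k⟩`. -/
def tensorForm : E ⊗[ℂ] H →ₗ⋆[ℂ] E ⊗[ℂ] H →ₗ[ℂ] ℂ :=
  TensorProduct.lift (LinearMap.mk₂'ₛₗ (starRingEnd ℂ) (starRingEnd ℂ)
    (fun (x : E) (h : H) => TensorProduct.lift (LinearMap.mk₂ ℂ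
      (fun (y : E) (k : H) => inner ℂ h (φ (inner B x y) k))
      (fun y y' k => by
        rw [SemiHilbertModule.inner_add_right, map_add, _root_.add_apply,
          _root_.inner_add_right])
      (fun c y k => by
        rw [SemiHilbertModule.inner_smul_right, map_smul, _root_.smul_apply,
          _root_.inner_smul_right, smul_eq_mul])
      (fun y k k' => by rw [map_add, _root_.inner_add_right])
      (fun c y k => by rw [map_smul, _root_.inner_smul_right, smul_eq_mul])))
    (fun x x' h => TensorProduct.ext' fun y k => by
      simp only [TensorProduct.lift.tmul, LinearMap.mk₂_apply, LinearMap.add_apply]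
      rw [SemiHilbertModule.inner_add_left, map_add, _root_.add_apply, _root_.inner_add_right])
    (fun c x h => TensorProduct.ext' fun y k => by
      simp only [TensorProduct.lift.tmul, LinearMap.mk₂_apply, LinearMap.smul_apply]
      rw [SemiHilbertModule.inner_smul_left, map_smul, _root_.smul_apply,
        _root_.inner_smul_right, smul_eq_mul]
      rfl)
    (fun x h h' => TensorProduct.ext' fun y k => by
      simp only [TensorProduct.lift.tmul, LinearMap.mk₂_apply, LinearMap.add_apply]
      rw [_root_.inner_add_left])
    (fun c x h => TensorProduct.ext' fun y k => by
      simp only [TensorProduct.lift.tmul, LinearMap.mk₂_apply, LinearMap.smul_apply]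
      rw [_root_.inner_smul_left, smul_eq_mul]))

variable {E}

theorem tensorForm_tmul (x y : E) (h k : H) :
    tensorForm E φ (x ⊗ₜ h) (y ⊗ₜ k) = inner ℂ h (φ (inner B x y) k) := rfl

theorem tensorForm_conj (ξ η : E ⊗[ℂ] H) :
    starRingEnd ℂ (tensorForm E φ η ξ) = tensorForm E φ ξ η := by
  induction ξ with
  | zero => simp
  | add ξ ξ' h h' => simp only [map_add, LinearMap.add_apply, h, h']
  | tmul x h =>
    induction η with
    | zero => simp
    | add η η' h h' => simp only [map_add, LinearMap.add_apply, h, h']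
    | tmul y k =>
      rw [tensorForm_tmul, tensorForm_tmul, inner_conj_symm, ← SemiHilbertModule.star_inner x y,
        map_star, ContinuousLinearMap.star_eq_adjoint, ContinuousLinearMap.adjoint_inner_left]

theorem tensorForm_self_nonneg (hφ : Continuous φ) (ξ : E ⊗[ℂ] H) :
    0 ≤ (tensorForm E φ ξ ξ).re := by
  obtain ⟨p, C, hC, hp⟩ := exists_bound_rep φ hφ
  obtain ⟨n, x, h, rfl⟩ := exists_fin_sum_tmul ξ
  obtain ⟨m, hm⟩ := exists_gram_factorization p x
  have key : ∀ i j, φ (inner B (x i) (x j)) =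
      ∑ k, ContinuousLinearMap.adjoint (φ (m k i)) ∘L φ (m k j) := fun i j => by
    have h1 : p (inner B (x i) (x j) - ∑ k, star (m k i) * m k j) = 0 := S.sub_eq_zero (hm i j)
    have h2 : φ (inner B (x i) (x j) - ∑ k, star (m k i) * m k j) = 0 :=
      norm_le_zero_iff.1 ((hp _).trans (by rw [h1, mul_zero]))
    rw [map_sub, sub_eq_zero, map_sum] at h2
    rw [h2]
    refine Finset.sum_congr rfl fun k _ => ?_
    rw [map_mul, map_star]
    rfl
  have : tensorForm E φ (∑ i, x i ⊗ₜ h i) (∑ i, x i ⊗ₜ h i) =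
      ∑ k, inner ℂ (∑ i, φ (m k i) (h i)) (∑ i, φ (m k i) (h i)) := by
    simp only [map_sum, LinearMap.sum_apply, tensorForm_tmul, key, _root_.sum_apply,
      _root_.inner_sum, _root_.sum_inner, ContinuousLinearMap.comp_apply,
      ContinuousLinearMap.adjoint_inner_right]
    rw [Finset.sum_comm]
    refine (Finset.sum_congr rfl fun i _ => Finset.sum_comm).trans ?_
    rw [Finset.sum_comm]
    refine Finset.sum_congr rfl fun k _ => Finset.sum_comm
  rw [this, Complex.re_sum]
  exact Finset.sum_nonneg fun k _ => inner_self_nonneg (𝕜 := ℂ)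

variable (E)

/-- The space `E ⊗ H` with the semi-inner product `⟨x ⊗ h, y ⊗ k⟩ = ⟨h, φ(⟪x, y⟫) k⟩`. -/
def PreTensor (_hφ : Continuous φ) : Type _ := E ⊗[ℂ] H

variable (hφ : Continuous φ)

namespace PreTensor

instance : AddCommGroup (PreTensor E φ hφ) := inferInstanceAs (AddCommGroup (E ⊗[ℂ] H))
instance : Module ℂ (PreTensor E φ hφ) := inferInstanceAs (Module ℂ (E ⊗[ℂ] H))

/-- The semi-inner product. -/
@[reducible]
def core : PreInnerProductSpace.Core ℂ (PreTensor E φ hφ) where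
  inner ξ η := tensorForm E φ ξ η
  conj_inner_symm := tensorForm_conj φ
  re_inner_nonneg := tensorForm_self_nonneg φ hφ
  add_left ξ η ζ := LinearMap.congr_fun (map_add (tensorForm E φ) ξ η) ζ
  smul_left ξ η c := LinearMap.congr_fun ((tensorForm E φ).map_smulₛₗ c ξ) η

instance : SeminormedAddCommGroup (PreTensor E φ hφ) :=
  InnerProductSpace.Core.toSeminormedAddCommGroup (c := core E φ hφ)

instance : InnerProductSpace ℂ (PreTensor E φ hφ) := InnerProductSpace.ofCore (core E φ hφ)

variable {E} in
/-- The elementary tensor `x ⊗ h`. -/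
def tmul (x : E) (h : H) : PreTensor E φ hφ := x ⊗ₜ[ℂ] h

variable {E φ hφ}

theorem inner_tmul (x y : E) (h k : H) :
    inner ℂ (tmul φ hφ x h) (tmul φ hφ y k) = inner ℂ h (φ (inner B x y) k) := rfl

theorem exists_sum (ξ : PreTensor E φ hφ) :
    ∃ (n : ℕ) (x : Fin n → E) (h : Fin n → H), ξ = ∑ i, tmul φ hφ (x i) (h i) :=
  exists_fin_sum_tmul ξ

theorem induction {P : PreTensor E φ hφ → Prop} (h0 : ∀ x h, P (tmul φ hφ x h))
    (hadd : ∀ ξ η, P ξ → P η → P (ξ + η)) (ξ : PreTensor E φ hφ) : P ξ :=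
  TensorProduct.induction_on ξ (by
    have := h0 0 0
    rwa [tmul, TensorProduct.zero_tmul] at this) h0 hadd

theorem norm_tmul_le {p : S B} {C : ℝ} (hC : 0 ≤ C) (hp : ∀ b, ‖φ b‖ ≤ C ^ 2 * p b) (x : E)
    (h : H) : ‖tmul φ hφ x h‖ ≤ C * bar p x * ‖h‖ := by
  refine le_of_sq_le_sq ?_ (mul_nonneg (mul_nonneg hC (apply_nonneg _ _)) (norm_nonneg h))
  rw [← inner_self_eq_norm_sq (𝕜 := ℂ), inner_tmul]
  refine (RCLike.re_le_norm _).trans ((norm_inner_le_norm _ _).trans ?_)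
  calc ‖h‖ * ‖φ (inner B x x) h‖ ≤ ‖h‖ * (C ^ 2 * p (inner B x x) * ‖h‖) :=
        mul_le_mul_of_nonneg_left (((φ _).le_opNorm h).trans
          (mul_le_mul_of_nonneg_right (hp _) (norm_nonneg h))) (norm_nonneg h)
    _ = _ := by rw [← bar_sq]; ring

end PreTensor

/-- `_E H`: the Hausdorff completion of `E ⊗ H`, that is, the completion of the quotient of
`E ⊗ H` by the null vectors of the semi-inner product. -/
def EH : Type _ := UniformSpace.Completion (PreTensor E φ hφ)

namespace EH

instance : NormedAddCommGroup (EH E φ hφ) :=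
  inferInstanceAs (NormedAddCommGroup (UniformSpace.Completion (PreTensor E φ hφ)))

instance : InnerProductSpace ℂ (EH E φ hφ) :=
  inferInstanceAs (InnerProductSpace ℂ (UniformSpace.Completion (PreTensor E φ hφ)))

instance : CompleteSpace (EH E φ hφ) :=
  inferInstanceAs (CompleteSpace (UniformSpace.Completion (PreTensor E φ hφ)))

variable {E} in
/-- The element `x ⊗ h` of `_E H`. -/
def tmul (x : E) (h : H) : EH E φ hφ :=
  UniformSpace.Completion.coe' (PreTensor.tmul φ hφ x h)

/-- The canonical map `E ⊗ H → _E H`. -/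
def of : PreTensor E φ hφ →ₗ[ℂ] EH E φ hφ :=
  (UniformSpace.Completion.toComplₗᵢ (𝕜 := ℂ) (E := PreTensor E φ hφ)).toLinearMap

variable {E φ hφ}

theorem of_tmul (x : E) (h : H) : of E φ hφ (PreTensor.tmul φ hφ x h) = tmul φ hφ x h := rfl

theorem inner_of (ξ η : PreTensor E φ hφ) : inner ℂ (of E φ hφ ξ) (of E φ hφ η) = inner ℂ ξ η :=
  UniformSpace.Completion.inner_coe ξ η

theorem norm_of (ξ : PreTensor E φ hφ) : ‖of E φ hφ ξ‖ = ‖ξ‖ := UniformSpace.Completion.norm_coe ξ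

theorem inner_tmul (x y : E) (h k : H) :
    inner ℂ (tmul φ hφ x h) (tmul φ hφ y k) = inner ℂ h (φ (inner B x y) k) :=
  inner_of _ _

theorem denseRange_of : DenseRange (of E φ hφ) := UniformSpace.Completion.denseRange_coe

theorem ext_of {X : Type*} [TopologicalSpace X] [T2Space X] {f g : EH E φ hφ → X}
    (hf : Continuous f) (hg : Continuous g) (h : ∀ ξ, f (of E φ hφ ξ) = g (of E φ hφ ξ)) :
    f = g :=
  denseRange_of.equalizer hf hg (funext h)

/-- Extension of a bounded operator `E ⊗ H → F ⊗ H` to `_E H → _F H`. -/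
def extend {F : Type*} [AddCommGroup F] [Module ℂ F] [SMul Bᵐᵒᵖ F] [SemiHilbertModule B F]
    (f : PreTensor E φ hφ →ₗ[ℂ] PreTensor F φ hφ) (h : ∃ M : ℝ, ∀ ξ, ‖f ξ‖ ≤ M * ‖ξ‖) :
    EH E φ hφ →L[ℂ] EH F φ hφ :=
  ContinuousLinearMap.completion (f.mkContinuousOfExistsBound h)

theorem extend_of {F : Type*} [AddCommGroup F] [Module ℂ F] [SMul Bᵐᵒᵖ F] [SemiHilbertModule B F]
    (f : PreTensor E φ hφ →ₗ[ℂ] PreTensor F φ hφ) (h : ∃ M : ℝ, ∀ ξ, ‖f ξ‖ ≤ M * ‖ξ‖)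
    (ξ : PreTensor E φ hφ) : extend f h (of E φ hφ ξ) = of F φ hφ (f ξ) :=
  ContinuousLinearMap.completion_apply_coe (f.mkContinuousOfExistsBound h) ξ

theorem norm_extend_le {F : Type*} [AddCommGroup F] [Module ℂ F] [SMul Bᵐᵒᵖ F]
    [SemiHilbertModule B F] (f : PreTensor E φ hφ →ₗ[ℂ] PreTensor F φ hφ) {M : ℝ} (hM : 0 ≤ M)
    (h : ∀ ξ, ‖f ξ‖ ≤ M * ‖ξ‖) : ‖extend f ⟨M, h⟩‖ ≤ M := by
  refine ContinuousLinearMap.opNorm_le_bound _ hM fun z => ?_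
  induction z using denseRange_of.induction_on with
  | hp => exact isClosed_le (by fun_prop) (by fun_prop)
  | ih ξ => rw [extend_of, norm_of, norm_of]; exact h ξ

end EH

end EH

/-! ### The operators `T ⊗ 1` -/

theorem le_of_iterate_bound {a : ℕ → ℝ} {K M : ℝ} (h0 : ∀ n, 0 ≤ a n)
    (h : ∀ n, a n ^ 2 ≤ a 0 * a (2 * n)) (hK : 0 ≤ K) (hM : ∀ n, a n ≤ M * K ^ n) :
    a 1 ≤ K * a 0 := by
  rcases (h0 0).eq_or_lt with e | e
  · have h1 := h 1
    rw [← e, zero_mul] at h1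
    rw [← e, mul_zero]
    exact (pow_eq_zero_iff two_ne_zero).1 (le_antisymm h1 (sq_nonneg _)) |>.le
  · by_contra hlt
    rw [not_le] at hlt
    have hr : K < a 1 / a 0 := by rwa [lt_div_iff₀ e]
    set r := a 1 / a 0 with hrdef
    have hr0 : 0 < r := hK.trans_lt hr
    have step : ∀ k : ℕ, r ^ (2 ^ k) * a 0 ≤ a (2 ^ k) := by
      intro k
      induction k with
      | zero => rw [pow_zero, pow_one, hrdef, div_mul_cancel₀ _ e.ne']
      | succ k ih =>
        have h2 := h (2 ^ k)
        have h3 : (r ^ (2 ^ k) * a 0) ^ 2 ≤ a (2 ^ k) ^ 2 :=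
          pow_le_pow_left₀ (by positivity) ih 2
        rw [pow_succ' 2 k]
        refine le_of_mul_le_mul_left ?_ e
        calc a 0 * (r ^ (2 * 2 ^ k) * a 0) = (r ^ (2 ^ k) * a 0) ^ 2 := by
              rw [mul_comm 2 (2 ^ k), pow_mul]; ring
          _ ≤ _ := h3.trans h2
    rcases hK.eq_or_lt with hK0 | hK0
    · have h1 := (step 0).trans (hM _)
      rw [pow_zero, ← hK0, pow_one, pow_one, mul_zero] at h1
      exact absurd h1 (not_le.2 (mul_pos hr0 e))
    · have hq : 1 < r / K := by rwa [one_lt_div hK0]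
      have hb : ∀ k : ℕ, (r / K) ^ (2 ^ k) ≤ M / a 0 := fun k => by
        rw [le_div_iff₀ e, div_pow, div_mul_eq_mul_div, div_le_iff₀ (by positivity)]
        exact (step k).trans (hM _)
      have ht : Tendsto (fun k : ℕ => (r / K) ^ (2 ^ k)) atTop atTop :=
        (tendsto_pow_atTop_atTop_of_one_lt hq).comp
          (tendsto_pow_atTop_atTop_of_one_lt one_lt_two)
      obtain ⟨k, hk⟩ := (ht.eventually_gt_atTop (M / a 0)).exists
      exact absurd (hb k) (not_le.2 hk)

section Ops

variable {B : Type u} [LocallyCStarAlgebra B]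
  {H : Type*} [NormedAddCommGroup H] [InnerProductSpace ℂ H] [CompleteSpace H]
  {E : Type v} [AddCommGroup E] [Module ℂ E] [SMul Bᵐᵒᵖ E] [PreHilbertModule B E]
  (φ : B →⋆ₙₐ[ℂ] (H →L[ℂ] H)) (hφ : Continuous φ)

/-- `T ⊗ 1` on `E ⊗ H`. -/
def tensorOne (T : L B E) : PreTensor E φ hφ →ₗ[ℂ] PreTensor E φ hφ :=
  LinearMap.rTensor H T.lin

variable {φ hφ}

theorem tensorOne_tmul (T : L B E) (x : E) (h : H) :
    tensorOne φ hφ T (PreTensor.tmul φ hφ x h) = PreTensor.tmul φ hφ (T x) h := rfl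

theorem tensorOne_mul (T R : L B E) (ξ : PreTensor E φ hφ) :
    tensorOne φ hφ (T * R) ξ = tensorOne φ hφ T (tensorOne φ hφ R ξ) := by
  induction ξ using PreTensor.induction with
  | h0 x h => rfl
  | hadd ξ η h h' => rw [map_add, map_add, map_add, h, h']

theorem tensorOne_add (T R : L B E) (ξ : PreTensor E φ hφ) :
    tensorOne φ hφ (T + R) ξ = tensorOne φ hφ T ξ + tensorOne φ hφ R ξ :=
  LinearMap.congr_fun (LinearMap.rTensor_add H T.lin R.lin) ξ

theorem tensorOne_smul (c : ℂ) (T : L B E) (ξ : PreTensor E φ hφ) :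
    tensorOne φ hφ (c • T) ξ = c • tensorOne φ hφ T ξ :=
  LinearMap.congr_fun (LinearMap.rTensor_smul H c T.lin) ξ

theorem tensorOne_one (ξ : PreTensor E φ hφ) : tensorOne φ hφ (1 : L B E) ξ = ξ :=
  LinearMap.congr_fun (LinearMap.rTensor_id H E) ξ

theorem inner_tensorOne_left (T : L B E) (ξ η : PreTensor E φ hφ) :
    inner ℂ (tensorOne φ hφ T ξ) η = inner ℂ ξ (tensorOne φ hφ (star T) η) := by
  induction ξ using PreTensor.induction with
  | hadd ξ ξ' h h' => rw [map_add, _root_.inner_add_left, _root_.inner_add_left, h, h']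
  | h0 x h =>
    induction η using PreTensor.induction with
    | hadd η η' h h' => rw [map_add, _root_.inner_add_right, _root_.inner_add_right, h, h']
    | h0 y k =>
      rw [tensorOne_tmul, tensorOne_tmul, PreTensor.inner_tmul, PreTensor.inner_tmul,
        L.inner_left]

theorem tilde_mul_le (q : S B) (T R : L B E) : tilde q (T * R) ≤ tilde q T * tilde q R := by
  refine ContinuousLinearMap.opNorm_le_bound _ (mul_nonneg (apply_nonneg _ _) (apply_nonneg _ _))
    (ModQuo.ind fun x => ?_)
  rw [mul_assoc]
  exact (bar_le_tilde q T (R x)).trans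
    (mul_le_mul_of_nonneg_left (bar_le_tilde q R x) (apply_nonneg _ _))

theorem norm_tensorOne_le {p : S B} {C : ℝ} (hC : 0 ≤ C) (hp : ∀ b, ‖φ b‖ ≤ C ^ 2 * p b)
    {R : L B E} (hR : star R = R) (ξ : PreTensor E φ hφ) :
    ‖tensorOne φ hφ R ξ‖ ≤ tilde p R * ‖ξ‖ := by
  obtain ⟨n, x, h, hξ⟩ := PreTensor.exists_sum ξ
  have hs : ∀ n : ℕ, star (R ^ n) = R ^ n := fun n => by rw [star_pow, hR]
  have h1 : ∀ n : ℕ, tilde p (R ^ (n + 1)) ≤ tilde p R ^ (n + 1) := by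
    intro n
    induction n with
    | zero => rw [zero_add, pow_one, pow_one]
    | succ n ih =>
      rw [pow_succ, pow_succ (tilde p R)]
      exact (tilde_mul_le p _ _).trans (mul_le_mul_of_nonneg_right ih (apply_nonneg _ _))
  have h2 : ∀ n : ℕ, ∀ x : E, bar p ((R ^ n : L B E) x) ≤ tilde p R ^ n * bar p x := by
    intro n x
    cases n with
    | zero => rw [pow_zero, pow_zero, one_mul]; rfl
    | succ n =>
      exact (bar_le_tilde p _ x).trans (mul_le_mul_of_nonneg_right (h1 n) (apply_nonneg _ _))
  have h3 := le_of_iterate_bound (a := fun n => ‖tensorOne φ hφ (R ^ n) ξ‖) (K := tilde p R)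
    (M := ∑ i, C * bar p (x i) * ‖h i‖) (fun n => norm_nonneg _) (fun n => ?_) (apply_nonneg _ _)
    (fun n => ?_)
  · simpa only [pow_one, pow_zero, tensorOne_one] using h3
  · rw [pow_zero, tensorOne_one, ← inner_self_eq_norm_sq (𝕜 := ℂ), inner_tensorOne_left, hs,
      ← tensorOne_mul, ← pow_add, ← two_mul]
    exact (RCLike.re_le_norm _).trans (norm_inner_le_norm _ _)
  · rw [hξ, map_sum, Finset.sum_mul]
    refine (norm_sum_le _ _).trans (Finset.sum_le_sum fun i _ => ?_)
    rw [tensorOne_tmul]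
    refine (PreTensor.norm_tmul_le hC hp _ _).trans ?_
    calc C * bar p ((R ^ n : L B E) (x i)) * ‖h i‖
        ≤ C * (tilde p R ^ n * bar p (x i)) * ‖h i‖ :=
          mul_le_mul_of_nonneg_right (mul_le_mul_of_nonneg_left (h2 n _) hC) (norm_nonneg _)
      _ = _ := by ring

theorem norm_tensorOne_sq_le {p : S B} {C : ℝ} (hC : 0 ≤ C) (hp : ∀ b, ‖φ b‖ ≤ C ^ 2 * p b)
    (T : L B E) (ξ : PreTensor E φ hφ) :
    ‖tensorOne φ hφ T ξ‖ ^ 2 ≤ tilde p (star T * T) * ‖ξ‖ ^ 2 := by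
  rw [← inner_self_eq_norm_sq (𝕜 := ℂ), inner_tensorOne_left, ← tensorOne_mul]
  refine (RCLike.re_le_norm _).trans ((norm_inner_le_norm _ _).trans ?_)
  calc ‖ξ‖ * ‖tensorOne φ hφ (star T * T) ξ‖ ≤ ‖ξ‖ * (tilde p (star T * T) * ‖ξ‖) :=
        mul_le_mul_of_nonneg_left
          (norm_tensorOne_le hC hp (by rw [star_mul, star_star]) ξ) (norm_nonneg _)
    _ = _ := by ring

theorem exists_bound_rep_sq (hφ : Continuous φ) :
    ∃ (p : S B) (C : ℝ), 0 ≤ C ∧ ∀ b, ‖φ b‖ ≤ C ^ 2 * p b := by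
  obtain ⟨p, C, hC, h⟩ := exists_bound_rep φ hφ
  exact ⟨p, √C, Real.sqrt_nonneg C, fun b => by rw [Real.sq_sqrt hC]; exact h b⟩

theorem exists_norm_tensorOne_le (T : L B E) :
    ∃ M : ℝ, ∀ ξ : PreTensor E φ hφ, ‖tensorOne φ hφ T ξ‖ ≤ M * ‖ξ‖ := by
  obtain ⟨p, C, hC, hp⟩ := exists_bound_rep_sq hφ
  refine ⟨√(tilde p (star T * T)), fun ξ => ?_⟩
  refine le_of_sq_le_sq ?_ (by positivity)
  rw [mul_pow, Real.sq_sqrt (apply_nonneg _ _)]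
  exact norm_tensorOne_sq_le hC hp T ξ

variable (φ hφ)

/-- `T ⊗ 1` on `_E H`. -/
def opOne (T : L B E) : EH E φ hφ →L[ℂ] EH E φ hφ :=
  EH.extend (tensorOne φ hφ T) (exists_norm_tensorOne_le T)

variable {φ hφ}

theorem opOne_of (T : L B E) (ξ : PreTensor E φ hφ) :
    opOne φ hφ T (EH.of E φ hφ ξ) = EH.of E φ hφ (tensorOne φ hφ T ξ) := EH.extend_of _ _ ξ

theorem opOne_tmul (T : L B E) (x : E) (h : H) :
    opOne φ hφ T (EH.tmul φ hφ x h) = EH.tmul φ hφ (T x) h := opOne_of T _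

theorem ext_op {R T : EH E φ hφ →L[ℂ] EH E φ hφ}
    (h : ∀ ξ, R (EH.of E φ hφ ξ) = T (EH.of E φ hφ ξ)) : R = T :=
  DFunLike.coe_injective (EH.ext_of R.continuous T.continuous h)

theorem opOne_smul (c : ℂ) (T : L B E) : opOne φ hφ (c • T) = c • opOne φ hφ T :=
  ext_op fun ξ => by
    rw [_root_.smul_apply, opOne_of, opOne_of, tensorOne_smul, map_smul]

variable (φ hφ)

/-- The ⋆-morphism `L_B(E) → B(_E H)`, `T ↦ T ⊗ 1`. -/
def ampliation : L B E →⋆ₙₐ[ℂ] (EH E φ hφ →L[ℂ] EH E φ hφ) where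
  toFun := opOne φ hφ
  map_smul' := opOne_smul
  map_zero' := by
    have := opOne_smul (φ := φ) (hφ := hφ) 0 (0 : L B E)
    rwa [zero_smul, zero_smul] at this
  map_add' T R := ext_op fun ξ => by
    rw [_root_.add_apply, opOne_of, opOne_of, opOne_of, tensorOne_add, map_add]
  map_mul' T R := ext_op fun ξ => by
    rw [mul_apply_eq_comp, opOne_of, opOne_of, opOne_of, tensorOne_mul]
  map_star' T := by
    rw [ContinuousLinearMap.star_eq_adjoint, ContinuousLinearMap.eq_adjoint_iff]
    intro z w
    refine congrFun (EH.ext_of (f := fun z => inner ℂ (opOne φ hφ (star T) z) w)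
      (g := fun z => inner ℂ z (opOne φ hφ T w)) (by fun_prop) (by fun_prop) fun ξ => ?_) z
    refine congrFun (EH.ext_of (f := fun w => inner ℂ (opOne φ hφ (star T) (EH.of E φ hφ ξ)) w)
      (g := fun w => inner ℂ (EH.of E φ hφ ξ) (opOne φ hφ T w)) (by fun_prop) (by fun_prop)
      fun η => ?_) w
    rw [opOne_of, opOne_of, EH.inner_of, EH.inner_of, inner_tensorOne_left, star_star]

variable {A : Type*} [LocallyCStarAlgebra A]

/-- The Rieffel induced representation `_E^A φ : A → B(_E H)`, `a ↦ Ψ(a) ⊗ 1`. -/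
def inducedφ (Ψ : A →⋆ₙₐ[ℂ] L B E) : A →⋆ₙₐ[ℂ] (EH E φ hφ →L[ℂ] EH E φ hφ) :=
  (ampliation φ hφ).comp Ψ

variable {φ hφ}

theorem inducedφ_tmul (Ψ : A →⋆ₙₐ[ℂ] L B E) (a : A) (x : E) (h : H) :
    inducedφ φ hφ Ψ a (EH.tmul φ hφ x h) = EH.tmul φ hφ (Ψ a x) h := opOne_tmul _ _ _

theorem exists_tilde_le {Ψ : A →⋆ₙₐ[ℂ] L B E} (hΨ : Continuous Ψ) (q : S B) :
    ∃ (p : S A) (C : ℝ), 0 ≤ C ∧ ∀ a, tilde q (Ψ a) ≤ C * p a :=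
  exists_bound_of_continuous (Ψ : A →ₗ[ℂ] L B E) (tilde q) ((tilde_continuous q).comp hΨ)

theorem inducedφ_continuous {Ψ : A →⋆ₙₐ[ℂ] L B E} (hΨ : Continuous Ψ) :
    Continuous (inducedφ φ hφ Ψ) := by
  obtain ⟨q, C, hC, hq⟩ := exists_bound_rep_sq hφ
  obtain ⟨p, D, hD, hp⟩ := exists_tilde_le hΨ q
  have key : ∀ a, ‖inducedφ φ hφ Ψ a‖ ≤ √D * p a := fun a => by
    refine EH.norm_extend_le _ (by positivity) fun ξ => le_of_sq_le_sq ?_ (by positivity)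
    refine (norm_tensorOne_sq_le hC hq _ ξ).trans ?_
    have h1 : star (Ψ a) * Ψ a = Ψ (star a * a) := by rw [map_mul, map_star]
    rw [mul_pow, mul_pow, Real.sq_sqrt hD, ← p.star_mul_self]
    exact mul_le_mul_of_nonneg_right ((congrArg (tilde q) h1).trans_le (hp _)) (sq_nonneg _)
  refine continuous_of_continuousAt_zero (inducedφ φ hφ Ψ) ?_
  rw [ContinuousAt, map_zero, tendsto_zero_iff_norm_tendsto_zero]
  have := p.continuous.tendsto 0
  rw [map_zero] at this
  have h2 := this.const_mul (√D)
  rw [mul_zero] at h2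
  exact squeeze_zero (fun _ => norm_nonneg _) key h2

end Ops

end

section

universe u v w

/-! ### The topology of a Hilbert module -/

section Top

variable {B : Type u} [LocallyCStarAlgebra B]
  {E : Type v} [AddCommGroup E] [Module ℂ E] [SMul Bᵐᵒᵖ E] [SemiHilbertModule B E]

variable (B E) in
theorem isUniformAddGroup_module : @IsUniformAddGroup E (hilbertUniformSpace B E) _ :=
  isUniformAddGroup_iInf fun q =>
    @SeminormedAddCommGroup.to_isUniformAddGroup E (bar (E := E) q).toSeminormedAddCommGroup

theorem bar_continuous (q : S B) : @Continuous E ℝ (hilbertTopology B E) _ (bar q) := by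
  have h : @UniformContinuous E ℝ (hilbertUniformSpace B E) _ (bar q) :=
    uniformContinuous_iInf_dom (i := q)
      (@uniformContinuous_norm E (bar (E := E) q).toSeminormedAddCommGroup.toSeminormedAddGroup)
  exact @UniformContinuous.continuous E ℝ (hilbertUniformSpace B E) _ _ h

theorem uniformContinuous_module (f : E →+ E)
    (hf : ∀ q : S B, ∃ k : ℝ, ∀ x, bar q (f x) ≤ k * bar q x) :
    @UniformContinuous E E (hilbertUniformSpace B E) (hilbertUniformSpace B E) f := by
  refine uniformContinuous_iInf_rng.2 fun q => uniformContinuous_iInf_dom (i := q) ?_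
  obtain ⟨k, hk⟩ := hf q
  let _ := (bar (E := E) q).toSeminormedAddCommGroup
  exact AddMonoidHomClass.uniformContinuous_of_bound f k hk

theorem continuous_algebra (f : B →+ B) (hf : ∀ q : S B, ∃ k : ℝ, ∀ b, q (f b) ≤ k * q b) :
    Continuous f := by
  refine continuous_of_continuousAt_zero f ?_
  rw [ContinuousAt, map_zero, tendsto_zero_iff]
  intro q
  obtain ⟨k, hk⟩ := hf q
  have := q.continuous.tendsto 0
  rw [map_zero] at this
  have h2 := this.const_mul k
  rw [mul_zero] at h2
  exact squeeze_zero (fun _ => apply_nonneg q _) hk h2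

theorem continuous_mul_right' (b : B) : Continuous fun a : B => a * b :=
  continuous_algebra (AddMonoidHom.mulRight b) fun q =>
    ⟨q b, fun a => (q.mul_le a b).trans_eq (mul_comm _ _)⟩

theorem continuous_star' : Continuous fun a : B => star a :=
  continuous_algebra (starAddEquiv : B ≃+ B).toAddMonoidHom fun q =>
    ⟨1, fun a => by rw [one_mul]; exact (q.map_star a).le⟩

theorem continuous_const_smul' (c : ℂ) : Continuous fun a : B => c • a :=
  continuous_algebra (DistribSMul.toAddMonoidHom B c) fun q =>
    ⟨‖c‖, fun a => (map_smul_eq_mul q c a).le⟩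

/-- The inner product of a Hilbert module is jointly continuous. -/
theorem continuous_inner_module :
    @Continuous (E × E) B (@instTopologicalSpaceProd E E (hilbertTopology B E)
      (hilbertTopology B E)) _ fun z => inner B z.1 z.2 := by
  let _ : UniformSpace E := hilbertUniformSpace B E
  have := isUniformAddGroup_module B E
  have hb : ∀ q : S B, Continuous (bar (E := E) q) := bar_continuous
  rw [continuous_iff_continuousAt]
  rintro ⟨x, y⟩
  rw [ContinuousAt, ← tendsto_sub_nhds_zero_iff, tendsto_zero_iff]
  intro q
  have h1 : Tendsto (fun z : E × E => bar q (z.1 - x) * bar q z.2 + bar q x * bar q (z.2 - y))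
      (𝓝 (x, y)) (𝓝 0) := by
    have h2 : Continuous fun z : E × E =>
        bar q (z.1 - x) * bar q z.2 + bar q x * bar q (z.2 - y) :=
      (((hb q).comp (continuous_fst.sub continuous_const)).mul ((hb q).comp continuous_snd)).add
        (continuous_const.mul ((hb q).comp (continuous_snd.sub continuous_const)))
    have h3 := h2.tendsto (x, y)
    simpa only [sub_self, map_zero, zero_mul, mul_zero, add_zero] using h3
  refine squeeze_zero (fun _ => apply_nonneg q _) (fun z => ?_) h1
  have e : inner B z.1 z.2 - inner B x y = inner B (z.1 - x) z.2 + inner B x (z.2 - y) := by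
    rw [SemiHilbertModule.inner_sub_left, SemiHilbertModule.inner_sub_right]
    abel
  rw [e]
  exact (map_add_le_add q _ _).trans (add_le_add (le_bar_mul_bar q _ _) (le_bar_mul_bar q _ _))

end Top

/-! ### The interior tensor product `V ⊗_Ψ E` -/

section Interior

variable {A : Type u} [LocallyCStarAlgebra A] {B : Type v} [LocallyCStarAlgebra B]
  {E : Type*} [AddCommGroup E] [Module ℂ E] [SMul Bᵐᵒᵖ E] [PreHilbertModule B E]
  (V : Type*) [AddCommGroup V] [Module ℂ V] [SMul Aᵐᵒᵖ V] [SemiHilbertModule A V]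
  (Ψ : A →⋆ₙₐ[ℂ] L B E)

/-- The sesquilinear map on `V ⊗ E` with `⟪v ⊗ x, w ⊗ y⟫ = ⟪x, Ψ(⟪v, w⟫) y⟫`. -/
def interiorForm : V ⊗[ℂ] E →ₗ⋆[ℂ] V ⊗[ℂ] E →ₗ[ℂ] B :=
  TensorProduct.lift (LinearMap.mk₂'ₛₗ (starRingEnd ℂ) (starRingEnd ℂ)
    (fun (v : V) (x : E) => TensorProduct.lift (LinearMap.mk₂ ℂ
      (fun (w : V) (y : E) => inner B x (Ψ (inner A v w) y))
      (fun w w' y => by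
        rw [SemiHilbertModule.inner_add_right, map_add, L.add_apply,
          SemiHilbertModule.inner_add_right])
      (fun c w y => by
        rw [SemiHilbertModule.inner_smul_right, map_smul, L.smul_apply,
          SemiHilbertModule.inner_smul_right])
      (fun w y y' => by rw [map_add, SemiHilbertModule.inner_add_right])
      (fun c w y => by rw [map_smul, SemiHilbertModule.inner_smul_right])))
    (fun v v' x => TensorProduct.ext' fun w y => by
      simp only [TensorProduct.lift.tmul, LinearMap.mk₂_apply, LinearMap.add_apply]
      rw [SemiHilbertModule.inner_add_left, map_add, L.add_apply,
        SemiHilbertModule.inner_add_right])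
    (fun c v x => TensorProduct.ext' fun w y => by
      simp only [TensorProduct.lift.tmul, LinearMap.mk₂_apply, LinearMap.smul_apply]
      rw [SemiHilbertModule.inner_smul_left, map_smul, L.smul_apply,
        SemiHilbertModule.inner_smul_right]
      rfl)
    (fun v x x' => TensorProduct.ext' fun w y => by
      simp only [TensorProduct.lift.tmul, LinearMap.mk₂_apply, LinearMap.add_apply]
      rw [SemiHilbertModule.inner_add_left])
    (fun c v x => TensorProduct.ext' fun w y => by
      simp only [TensorProduct.lift.tmul, LinearMap.mk₂_apply, LinearMap.smul_apply]
      rw [SemiHilbertModule.inner_smul_left]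
      rfl))

variable {V}

theorem interiorForm_tmul (v w : V) (x y : E) :
    interiorForm V Ψ (v ⊗ₜ x) (w ⊗ₜ y) = inner B x (Ψ (inner A v w) y) := rfl

theorem interiorForm_star (ξ η : V ⊗[ℂ] E) :
    star (interiorForm V Ψ ξ η) = interiorForm V Ψ η ξ := by
  induction ξ with
  | zero => simp
  | add ξ ξ' h h' => simp only [map_add, LinearMap.add_apply, star_add, h, h']
  | tmul v x =>
    induction η with
    | zero => simp
    | add η η' h h' => simp only [map_add, LinearMap.add_apply, star_add, h, h']
    | tmul w y =>
      rw [interiorForm_tmul, interiorForm_tmul, SemiHilbertModule.star_inner, L.inner_left,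
        ← map_star, SemiHilbertModule.star_inner]

/-- The right action of `b` on `E` as a linear map. -/
def rsmulLin (b : B) : E →ₗ[ℂ] E where
  toFun x := x <• b
  map_add' x y := SemiHilbertModule.add_rsmul x y b
  map_smul' c x := SemiHilbertModule.smul_rsmul c x b

theorem interiorForm_rsmul (ξ η : V ⊗[ℂ] E) (b : B) :
    interiorForm V Ψ ξ (LinearMap.lTensor V (rsmulLin b) η) = interiorForm V Ψ ξ η * b := by
  induction ξ with
  | zero => simp
  | add ξ ξ' h h' => simp only [map_add, LinearMap.add_apply, add_mul, h, h']
  | tmul v x =>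
    induction η with
    | zero => simp
    | add η η' h h' => simp only [map_add, add_mul, h, h']
    | tmul w y =>
      rw [LinearMap.lTensor_tmul, interiorForm_tmul, interiorForm_tmul]
      change inner B x (Ψ (inner A v w) (y <• b)) = _
      rw [(Ψ (inner A v w)).prop.map_rsmul, SemiHilbertModule.inner_rsmul_right]

theorem interiorForm_self_nonneg (hΨ : Continuous Ψ) (ξ : V ⊗[ℂ] E) :
    ∃ b : B, interiorForm V Ψ ξ ξ = star b * b := by
  refine exists_star_mul_self_of_forall _ fun q => ?_
  obtain ⟨p, C, hC, hp⟩ := exists_tilde_le hΨ q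
  obtain ⟨n, v, x, rfl⟩ := exists_fin_sum_tmul ξ
  obtain ⟨m, hm⟩ := exists_gram_factorization p v
  have key : ∀ i j, π q (inner B (x i) (Ψ (inner A (v i) (v j)) (x j))) =
      ∑ k, π q (inner B (Ψ (m k i) (x i)) (Ψ (m k j) (x j))) := fun i j => by
    have h1 : p (inner A (v i) (v j) - ∑ k, star (m k i) * m k j) = 0 := S.sub_eq_zero (hm i j)
    obtain ⟨d, hd⟩ : ∃ d, d = inner A (v i) (v j) - ∑ k, star (m k i) * m k j := ⟨_, rfl⟩
    rw [← hd] at h1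
    have h2 : bar q (Ψ d (x j)) = 0 := by
      refine le_antisymm ((bar_le_tilde q (Ψ d) (x j)).trans ?_) (apply_nonneg _ _)
      have h3 : tilde q (Ψ d) ≤ 0 := (hp d).trans (by rw [h1, mul_zero])
      exact mul_nonpos_of_nonpos_of_nonneg h3 (apply_nonneg _ _)
    have h3 := (π_inner_eq_zero h2 (x i)).2
    have h4 : inner A (v i) (v j) = d + ∑ k, star (m k i) * m k j := by
      rw [hd, sub_add_cancel]
    rw [h4, map_add, L.add_apply, SemiHilbertModule.inner_add_right, map_add, h3, zero_add,
      ← map_sum]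
    refine congrArg (π q) ?_
    have h5 : ∀ s : Finset (Fin n), inner B (x i) (Ψ (∑ k ∈ s, star (m k i) * m k j) (x j)) =
        ∑ k ∈ s, inner B (Ψ (m k i) (x i)) (Ψ (m k j) (x j)) := by
      intro s
      induction s using Finset.cons_induction with
      | empty =>
        rw [Finset.sum_empty, map_zero, Finset.sum_empty, L.zero_apply,
          SemiHilbertModule.inner_zero_right]
      | cons k s hk ih =>
        rw [Finset.sum_cons, Finset.sum_cons, map_add, L.add_apply,
          SemiHilbertModule.inner_add_right, ih, map_mul, map_star, L.mul_apply, L.inner_left]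
    exact h5 _
  have : π q (interiorForm V Ψ (∑ i, v i ⊗ₜ x i) (∑ i, v i ⊗ₜ x i)) =
      ∑ k, π q (inner B (∑ i, Ψ (m k i) (x i)) (∑ i, Ψ (m k i) (x i))) := by
    simp only [map_sum, LinearMap.sum_apply, interiorForm_tmul, key,
      SemiHilbertModule.inner_sum_left, SemiHilbertModule.inner_sum_right]
    refine (Finset.sum_congr rfl fun i _ => Finset.sum_comm).trans ?_
    rw [Finset.sum_comm]
  rw [this]
  exact Finset.sum_nonneg fun k _ => SemiHilbertModule.π_inner_self_nonneg q _

variable (V)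

/-- The algebraic tensor product `V ⊗ E` with the `B`-valued semi-inner product
`⟪v ⊗ x, w ⊗ y⟫ = ⟪x, Ψ(⟪v, w⟫) y⟫`. The elements `v a ⊗ x - v ⊗ Ψ(a) x` are null vectors, so the
Hausdorff completions of `V ⊗ E` and of the tensor product balanced over `A` coincide. -/
def PreInterior (_hΨ : Continuous Ψ) : Type _ := V ⊗[ℂ] E

variable (hΨ : Continuous Ψ)

namespace PreInterior

instance : AddCommGroup (PreInterior V Ψ hΨ) := inferInstanceAs (AddCommGroup (V ⊗[ℂ] E))
instance : Module ℂ (PreInterior V Ψ hΨ) := inferInstanceAs (Module ℂ (V ⊗[ℂ] E))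

/-- `(v ⊗ x) b = v ⊗ x b`. -/
instance : SMul Bᵐᵒᵖ (PreInterior V Ψ hΨ) where
  smul b ξ := LinearMap.lTensor V (rsmulLin b.unop) ξ

instance : SemiHilbertModule B (PreInterior V Ψ hΨ) where
  inner ξ η := interiorForm V Ψ ξ η
  add_rsmul ξ η b := map_add (LinearMap.lTensor V (rsmulLin b)) ξ η
  rsmul_add ξ a b := by
    have : rsmulLin (a + b) = rsmulLin (E := E) a + rsmulLin b :=
      LinearMap.ext fun x => SemiHilbertModule.rsmul_add x a b
    refine (congrArg (fun f => LinearMap.lTensor V f ξ) this).trans ?_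
    exact LinearMap.congr_fun (LinearMap.lTensor_add V _ _) ξ
  rsmul_mul ξ a b := by
    have : rsmulLin (a * b) = rsmulLin (E := E) b ∘ₗ rsmulLin a :=
      LinearMap.ext fun x => SemiHilbertModule.rsmul_mul x a b
    refine (congrArg (fun f => LinearMap.lTensor V f ξ) this).trans ?_
    exact LinearMap.lTensor_comp_apply V _ _ ξ
  smul_rsmul c ξ b := map_smul (LinearMap.lTensor V (rsmulLin b)) c ξ
  rsmul_smul c ξ b := by
    have : rsmulLin (c • b) = c • rsmulLin (E := E) b :=
      LinearMap.ext fun x => SemiHilbertModule.rsmul_smul c x b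
    refine (congrArg (fun f => LinearMap.lTensor V f ξ) this).trans ?_
    exact LinearMap.congr_fun (LinearMap.lTensor_smul V _ _) ξ
  inner_add_right ξ η ζ := map_add (interiorForm V Ψ ξ) η ζ
  inner_smul_right c ξ η := map_smul (interiorForm V Ψ ξ) c η
  inner_rsmul_right ξ η b := interiorForm_rsmul Ψ ξ η b
  star_inner ξ η := interiorForm_star Ψ ξ η
  inner_self_nonneg ξ := interiorForm_self_nonneg Ψ hΨ ξ

instance : UniformSpace (PreInterior V Ψ hΨ) := hilbertUniformSpace B _

instance : IsUniformAddGroup (PreInterior V Ψ hΨ) := isUniformAddGroup_module B _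

instance : UniformContinuousConstSMul ℂ (PreInterior V Ψ hΨ) where
  uniformContinuous_const_smul c := uniformContinuous_module (B := B)
    (DistribSMul.toAddMonoidHom (PreInterior V Ψ hΨ) c)
    fun q => ⟨‖c‖, fun ξ => (map_smul_eq_mul (bar q) c ξ).le⟩

instance : UniformContinuousConstSMul Bᵐᵒᵖ (PreInterior V Ψ hΨ) where
  uniformContinuous_const_smul b := uniformContinuous_module (B := B)
    (AddMonoidHom.mk' (fun ξ : PreInterior V Ψ hΨ => b • ξ)
      fun ξ η => SemiHilbertModule.add_rsmul ξ η b.unop)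
    fun q => ⟨q b.unop, fun ξ => (bar_rsmul_le q ξ b.unop).trans_eq (mul_comm _ _)⟩

end PreInterior

/-- `V ⊗_Ψ E`: the Hausdorff completion of `V ⊗ E`. -/
def Interior : Type _ := UniformSpace.Completion (PreInterior V Ψ hΨ)

namespace Interior

open UniformSpace (Completion)

instance : AddCommGroup (Interior V Ψ hΨ) :=
  inferInstanceAs (AddCommGroup (Completion (PreInterior V Ψ hΨ)))

instance : Module ℂ (Interior V Ψ hΨ) :=
  inferInstanceAs (Module ℂ (Completion (PreInterior V Ψ hΨ)))

instance : SMul Bᵐᵒᵖ (Interior V Ψ hΨ) :=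
  inferInstanceAs (SMul Bᵐᵒᵖ (Completion (PreInterior V Ψ hΨ)))

instance : UniformSpace (Interior V Ψ hΨ) :=
  inferInstanceAs (UniformSpace (Completion (PreInterior V Ψ hΨ)))

instance : IsUniformAddGroup (Interior V Ψ hΨ) :=
  inferInstanceAs (IsUniformAddGroup (Completion (PreInterior V Ψ hΨ)))

instance : CompleteSpace (Interior V Ψ hΨ) :=
  inferInstanceAs (CompleteSpace (Completion (PreInterior V Ψ hΨ)))

instance : T2Space (Interior V Ψ hΨ) :=
  inferInstanceAs (T2Space (Completion (PreInterior V Ψ hΨ)))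

instance : UniformContinuousConstSMul ℂ (Interior V Ψ hΨ) :=
  inferInstanceAs (UniformContinuousConstSMul ℂ (Completion (PreInterior V Ψ hΨ)))

instance : UniformContinuousConstSMul Bᵐᵒᵖ (Interior V Ψ hΨ) :=
  inferInstanceAs (UniformContinuousConstSMul Bᵐᵒᵖ (Completion (PreInterior V Ψ hΨ)))

/-- The inner product is the continuous extension of that of `V ⊗ E`. -/
instance : Inner B (Interior V Ψ hΨ) :=
  inferInstanceAs (Inner B (Completion (PreInterior V Ψ hΨ)))

/-- The canonical map `V ⊗ E → V ⊗_Ψ E`. -/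
def of : PreInterior V Ψ hΨ →ₗ[ℂ] Interior V Ψ hΨ where
  toFun := fun ξ => (ξ : Completion (PreInterior V Ψ hΨ))
  map_add' := Completion.coe_add
  map_smul' := Completion.coe_smul

variable {V Ψ hΨ}

theorem of_rsmul (ξ : PreInterior V Ψ hΨ) (b : B) : of V Ψ hΨ (ξ <• b) = of V Ψ hΨ ξ <• b :=
  Completion.coe_smul _ _

theorem denseRange_of : DenseRange (of V Ψ hΨ) := Completion.denseRange_coe

theorem inner_of (ξ η : PreInterior V Ψ hΨ) :
    inner B (of V Ψ hΨ ξ) (of V Ψ hΨ η) = inner B ξ η :=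
  (Completion.isDenseInducing_coe.prodMap Completion.isDenseInducing_coe).extend_eq
    (continuous_inner_module (B := B) (E := PreInterior V Ψ hΨ)) (ξ, η)

theorem continuous_inner :
    Continuous fun z : Interior V Ψ hΨ × Interior V Ψ hΨ => inner B z.1 z.2 := by
  let inner' : PreInterior V Ψ hΨ →+ PreInterior V Ψ hΨ →+ B :=
    AddMonoidHom.mk' (fun ξ => (SemiHilbertModule.innerₛₗ B ξ).toAddMonoidHom) fun ξ η =>
      AddMonoidHom.ext fun ζ => SemiHilbertModule.inner_add_left B ξ η ζ
  have : Continuous fun z : PreInterior V Ψ hΨ × PreInterior V Ψ hΨ => inner' z.1 z.2 :=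
    continuous_inner_module (B := B) (E := PreInterior V Ψ hΨ)
  exact (Completion.isDenseInducing_toCompl (PreInterior V Ψ hΨ)).extend_Z_bilin
    (Completion.isDenseInducing_toCompl (PreInterior V Ψ hΨ)) this

theorem induction {P : Interior V Ψ hΨ → Prop} (hP : IsClosed {z | P z})
    (h : ∀ ξ, P (of V Ψ hΨ ξ)) (z : Interior V Ψ hΨ) : P z :=
  denseRange_of.induction_on z hP h

theorem continuous_inner₂ {X : Type*} [TopologicalSpace X] {f g : X → Interior V Ψ hΨ}
    (hf : Continuous f) (hg : Continuous g) : Continuous fun x => inner B (f x) (g x) :=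
  continuous_inner.comp (hf.prodMk hg)

theorem continuous_rsmul (b : B) : Continuous fun z : Interior V Ψ hΨ => z <• b :=
  continuous_const_smul (MulOpposite.op b)

instance instSemiHilbertModule : SemiHilbertModule B (Interior V Ψ hΨ) where
  add_rsmul x y b := by
    induction x using induction with
    | hP =>
      exact isClosed_eq ((continuous_rsmul b).comp (continuous_id.add continuous_const))
        ((continuous_rsmul b).add continuous_const)
    | h ξ =>
      induction y using induction with
      | hP =>
        exact isClosed_eq ((continuous_rsmul b).comp (continuous_const.add continuous_id))
          (continuous_const.add (continuous_rsmul b))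
      | h η =>
        rw [← map_add, ← of_rsmul, ← of_rsmul, ← of_rsmul, ← map_add,
          SemiHilbertModule.add_rsmul]
  rsmul_add x a b := by
    induction x using induction with
    | hP =>
      exact isClosed_eq (continuous_rsmul _) ((continuous_rsmul a).add (continuous_rsmul b))
    | h ξ =>
      rw [← of_rsmul, ← of_rsmul, ← of_rsmul, ← map_add, SemiHilbertModule.rsmul_add]
  rsmul_mul x a b := by
    induction x using induction with
    | hP =>
      exact isClosed_eq (continuous_rsmul _) ((continuous_rsmul b).comp (continuous_rsmul a))
    | h ξ => rw [← of_rsmul, ← of_rsmul, ← of_rsmul, SemiHilbertModule.rsmul_mul]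
  smul_rsmul c x b := by
    induction x using induction with
    | hP =>
      exact isClosed_eq ((continuous_rsmul b).comp (continuous_const_smul c))
        ((continuous_const_smul c).comp (continuous_rsmul b))
    | h ξ => rw [← map_smul, ← of_rsmul, ← of_rsmul, ← map_smul, SemiHilbertModule.smul_rsmul]
  rsmul_smul c x b := by
    induction x using induction with
    | hP =>
      exact isClosed_eq (continuous_rsmul _) ((continuous_const_smul c).comp (continuous_rsmul b))
    | h ξ => rw [← of_rsmul, ← of_rsmul, ← map_smul, SemiHilbertModule.rsmul_smul]
  inner_add_right x y z := by
    induction x using induction with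
    | hP =>
      exact isClosed_eq (continuous_inner₂ continuous_id continuous_const)
        ((continuous_inner₂ continuous_id continuous_const).add
          (continuous_inner₂ continuous_id continuous_const))
    | h ξ =>
      induction y using induction with
      | hP =>
        exact isClosed_eq (continuous_inner₂ continuous_const (continuous_id.add continuous_const))
          ((continuous_inner₂ continuous_const continuous_id).add continuous_const)
      | h η =>
        induction z using induction with
        | hP =>
          exact isClosed_eq
            (continuous_inner₂ continuous_const (continuous_const.add continuous_id))
            (continuous_const.add (continuous_inner₂ continuous_const continuous_id))
        | h ζ => rw [← map_add, inner_of, inner_of, inner_of, SemiHilbertModule.inner_add_right]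
  inner_smul_right c x y := by
    induction x using induction with
    | hP =>
      exact isClosed_eq (continuous_inner₂ continuous_id continuous_const)
        ((continuous_const_smul' c).comp (continuous_inner₂ continuous_id continuous_const))
    | h ξ =>
      induction y using induction with
      | hP =>
        exact isClosed_eq (continuous_inner₂ continuous_const (continuous_const_smul c))
          ((continuous_const_smul' c).comp (continuous_inner₂ continuous_const continuous_id))
      | h η => rw [← map_smul, inner_of, inner_of, SemiHilbertModule.inner_smul_right]
  inner_rsmul_right x y b := by
    induction x using induction with
    | hP =>
      exact isClosed_eq (continuous_inner₂ continuous_id continuous_const)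
        ((continuous_mul_right' b).comp (continuous_inner₂ continuous_id continuous_const))
    | h ξ =>
      induction y using induction with
      | hP =>
        exact isClosed_eq (continuous_inner₂ continuous_const (continuous_rsmul b))
          ((continuous_mul_right' b).comp (continuous_inner₂ continuous_const continuous_id))
      | h η => rw [← of_rsmul, inner_of, inner_of, SemiHilbertModule.inner_rsmul_right]
  star_inner x y := by
    induction x using induction with
    | hP =>
      exact isClosed_eq (continuous_star'.comp (continuous_inner₂ continuous_id continuous_const))
        (continuous_inner₂ continuous_const continuous_id)
    | h ξ =>
      induction y using induction with
      | hP =>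
        exact isClosed_eq
          (continuous_star'.comp (continuous_inner₂ continuous_const continuous_id))
          (continuous_inner₂ continuous_id continuous_const)
      | h η => rw [inner_of, inner_of, SemiHilbertModule.star_inner]
  inner_self_nonneg x := by
    refine exists_star_mul_self_of_forall _ fun q => ?_
    induction x using induction with
    | hP =>
      exact isClosed_le continuous_const
        ((π_continuous q).comp (continuous_inner₂ continuous_id continuous_id))
    | h ξ =>
      rw [inner_of]
      exact SemiHilbertModule.π_inner_self_nonneg q ξ

/-- The element `v ⊗ x` of `V ⊗_Ψ E`. -/
def tmul (Ψ : A →⋆ₙₐ[ℂ] L B E) (hΨ : Continuous Ψ) (v : V) (x : E) : Interior V Ψ hΨ :=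
  of V Ψ hΨ (v ⊗ₜ[ℂ] x)

theorem inner_tmul (v w : V) (x y : E) :
    inner B (tmul Ψ hΨ v x) (tmul Ψ hΨ w y) = inner B x (Ψ (inner A v w) y) :=
  inner_of _ _

end Interior

end Interior

end

section

universe u v w

/-! ### The induced representation -/

section Induced

variable {A : Type u} [LocallyCStarAlgebra A] {B : Type v} [LocallyCStarAlgebra B]
  {E : Type*} [AddCommGroup E] [Module ℂ E] [SMul Bᵐᵒᵖ E] [PreHilbertModule B E]
  (V : Type*) [AddCommGroup V] [Module ℂ V] [SMul Aᵐᵒᵖ V] [SemiHilbertModule A V]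
  {W : Type*} [AddCommGroup W] [Module ℂ W] [SMul Bᵐᵒᵖ W] [SemiHilbertModule B W]
  {H : Type*} [NormedAddCommGroup H] [InnerProductSpace ℂ H] [CompleteSpace H]
  {K : Type*} [NormedAddCommGroup K] [InnerProductSpace ℂ K] [CompleteSpace K]
  (Ψ : A →⋆ₙₐ[ℂ] L B E) (hΨ : Continuous Ψ)

variable {V} in
/-- The linear map `x ↦ v ⊗ x` from `E` to `V ⊗_Ψ E`. -/
def creation (v : V) : E →ₗ[ℂ] Interior V Ψ hΨ :=
  Interior.of V Ψ hΨ ∘ₗ TensorProduct.mk ℂ V E v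

variable (φ : B →⋆ₙₐ[ℂ] (H →L[ℂ] H)) (hφ : Continuous φ)

variable {V} in
/-- The linear map `x ⊗ h ↦ v ⊗ x ⊗ h` from `E ⊗ H` to `(V ⊗_Ψ E) ⊗ H`. -/
def preInduced (v : V) : PreTensor E φ hφ →ₗ[ℂ] PreTensor (Interior V Ψ hΨ) φ hφ :=
  LinearMap.rTensor H (creation Ψ hΨ v)

variable {V Ψ hΨ φ hφ}

theorem preInduced_tmul (v : V) (x : E) (h : H) :
    preInduced Ψ hΨ φ hφ v (PreTensor.tmul φ hφ x h) =
      PreTensor.tmul φ hφ (Interior.tmul Ψ hΨ v x) h := rfl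

theorem inner_preInduced (v w : V) (ξ η : PreTensor E φ hφ) :
    inner ℂ (preInduced Ψ hΨ φ hφ v ξ) (preInduced Ψ hΨ φ hφ w η) =
      inner ℂ ξ (tensorOne φ hφ (Ψ (inner A v w)) η) := by
  induction ξ using PreTensor.induction with
  | hadd ξ ξ' h h' => rw [map_add, _root_.inner_add_left, _root_.inner_add_left, h, h']
  | h0 x h =>
    induction η using PreTensor.induction with
    | hadd η η' h h' =>
      rw [map_add, _root_.inner_add_right, map_add, _root_.inner_add_right, h, h']
    | h0 y k =>
      rw [preInduced_tmul, preInduced_tmul, tensorOne_tmul, PreTensor.inner_tmul,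
        PreTensor.inner_tmul, Interior.inner_tmul]

theorem exists_norm_preInduced_le (v : V) :
    ∃ M : ℝ, ∀ ξ : PreTensor E φ hφ, ‖preInduced Ψ hΨ φ hφ v ξ‖ ≤ M * ‖ξ‖ := by
  obtain ⟨M, hM⟩ := exists_norm_tensorOne_le (φ := φ) (hφ := hφ) (Ψ (inner A v v))
  refine ⟨√|M|, fun ξ => le_of_sq_le_sq ?_ (by positivity)⟩
  rw [mul_pow, Real.sq_sqrt (abs_nonneg M), ← inner_self_eq_norm_sq (𝕜 := ℂ), inner_preInduced]
  refine (RCLike.re_le_norm _).trans ((norm_inner_le_norm _ _).trans ?_)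
  calc ‖ξ‖ * ‖tensorOne φ hφ (Ψ (inner A v v)) ξ‖ ≤ ‖ξ‖ * (|M| * ‖ξ‖) :=
        mul_le_mul_of_nonneg_left ((hM ξ).trans
          (mul_le_mul_of_nonneg_right (le_abs_self M) (norm_nonneg _))) (norm_nonneg _)
    _ = _ := by ring

variable (V Ψ hΨ)

open ContinuousLinearMap (adjoint) in
/-- The Rieffel induced representation `_E^V Φ : V → B(_E H, _{V ⊗_Ψ E} H)` from `W` to `V`
via `E`, `_E^V Φ(v)(x ⊗ h) = v ⊗ x ⊗ h`. It is an `_E^A φ`-morphism. -/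
def inducedRep (Φ : HilbertRep B W H K) :
    HilbertRep A V (EH E Φ.φ Φ.continuous_φ) (EH (Interior V Ψ hΨ) Φ.φ Φ.continuous_φ) where
  φ := inducedφ Φ.φ Φ.continuous_φ Ψ
  continuous_φ := inducedφ_continuous hΨ
  toFun v := EH.extend (preInduced Ψ hΨ Φ.φ Φ.continuous_φ v) (exists_norm_preInduced_le v)
  adjoint_comp v w := ext_op fun ξ => by
    refine ext_inner_left ℂ fun z => ?_
    refine congrFun (EH.ext_of (X := ℂ) (f := fun z => inner ℂ z _) (g := fun z => inner ℂ z _)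
      (by fun_prop) (by fun_prop) fun η => ?_) z
    rw [ContinuousLinearMap.comp_apply, ContinuousLinearMap.adjoint_inner_right, EH.extend_of,
      EH.extend_of, EH.inner_of, inner_preInduced]
    exact ((congrArg (inner ℂ (EH.of E _ Φ.continuous_φ η)) (opOne_of _ ξ)).trans
      (EH.inner_of _ _)).symm

theorem inducedRep_tmul (Φ : HilbertRep B W H K) (v : V) (x : E) (h : H) :
    inducedRep V Ψ hΨ Φ v (EH.tmul _ Φ.continuous_φ x h) =
      EH.tmul _ Φ.continuous_φ (Interior.tmul Ψ hΨ v x) h :=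
  EH.extend_of _ _ _

end Induced

end

end

end LocCStar

open LocCStar

/-!
Since `Ψ` is continuous, there are `p ∈ S(A)` and `C ≥ 0` with `q̃(Ψ a) ≤ C p(a)` for all `a`, so
`(π_q)_* ∘ Ψ` vanishes on the kernel of `p` and factors through `A_p`: this is `descend`, the
morphism `Ψ_p`.

The topology of `L_{B_q}(E_q)` is given by the seminorms `r̃` of *all* continuous C⋆-seminorms `r`
on `B_q`, not by the operator norm alone, so the continuity of `Ψ_p` (`descend_continuous`) needs
`r̃(Ψ_p(π_p a))² ≤ q̃(Ψ(a⋆ a))`. This holds because `r ≤ ‖·‖` on the C⋆-algebra `B_q`, and because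
self-adjoint operators satisfy the bound of `bar_pullS_apply_le`. Non-degeneracy passes to `Ψ_p`
because `σ_q : E → E_q` is continuous and onto (`descend_nondegenerate`).

For the equivalence, the vectors `x ⊗ h` span a dense subspace of `_E H`, and the vectors
`v ⊗ x ⊗ h` span a dense subspace of `_{V ⊗_Ψ E} H`. The inner products
`⟨h, φ(⟪x, y⟫) k⟩` and `⟨h, φ(⟪x, Ψ(⟪v, w⟫) y⟫) k⟩` of such vectors agree with those of their images
under `σ_q` and `σ_p`, as `φ = φ_q ∘ π_q` and `Ψ_p ∘ π_p = (π_q)_* ∘ Ψ`. Families with dense spans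
and equal Gram matrices are unitarily equivalent (`exists_unitary_of_gram_eq`), and the two
unitaries so obtained intertwine the induced representations on elementary tensors, hence
everywhere (`inducedRep_unitarilyEquivalent`).
-/

namespace LocCStar

open scoped Topology RightActions TensorProduct
open Filter

noncomputable section

/-! ### Hilbert spaces with equal Gram matrices -/

section Gram

variable {ι X Y : Type*} [NormedAddCommGroup X] [InnerProductSpace ℂ X] [CompleteSpace X]
  [NormedAddCommGroup Y] [InnerProductSpace ℂ Y] [CompleteSpace Y]

/-- Two families of vectors with dense linear spans and the same Gram matrix are carried to each
other by a unitary. -/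
theorem exists_unitary_of_gram_eq {k : ι → X} {l : ι → Y}
    (hk : Dense (Submodule.span ℂ (Set.range k) : Set X))
    (hl : Dense (Submodule.span ℂ (Set.range l) : Set Y))
    (h : ∀ i j, inner ℂ (k i) (k j) = inner ℂ (l i) (l j)) :
    ∃ U : X ≃ₗᵢ[ℂ] Y, ∀ i, U (k i) = l i := by
  have hk' : DenseRange (Finsupp.linearCombination ℂ k) := by
    rwa [DenseRange, ← LinearMap.coe_range, Finsupp.range_linearCombination]
  have hl' : DenseRange (Finsupp.linearCombination ℂ l) := by
    rwa [DenseRange, ← LinearMap.coe_range, Finsupp.range_linearCombination]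
  have hn : ∀ c : ι →₀ ℂ, ‖Finsupp.linearCombination ℂ l (LinearEquiv.refl ℂ _ c)‖ =
      ‖Finsupp.linearCombination ℂ k c‖ := fun c => by
    rw [LinearEquiv.refl_apply, @norm_eq_sqrt_re_inner ℂ, @norm_eq_sqrt_re_inner ℂ]
    simp only [Finsupp.linearCombination_apply, Finsupp.sum, sum_inner, inner_sum,
      _root_.inner_smul_left, _root_.inner_smul_right, h]
  refine ⟨(LinearEquiv.refl ℂ (ι →₀ ℂ)).extendOfIsometry _ _ hk' hl' hn, fun i => ?_⟩
  have := LinearEquiv.extendOfIsometry_eq (LinearEquiv.refl ℂ (ι →₀ ℂ)) _ _ hk' hl' hn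
    (Finsupp.single i 1)
  simpa using this

end Gram

/-! ### Total families in `_E H` and `_{V ⊗_Ψ E} H` -/

section Total

variable {B : Type*} [LocallyCStarAlgebra B]
  {H : Type*} [NormedAddCommGroup H] [InnerProductSpace ℂ H] [CompleteSpace H]
  (φ : B →⋆ₙₐ[ℂ] (H →L[ℂ] H)) (hφ : Continuous φ)

theorem EH.dense_span_tmul {F : Type*} [AddCommGroup F] [Module ℂ F] [SMul Bᵐᵒᵖ F]
    [SemiHilbertModule B F] :
    Dense (Submodule.span ℂ (Set.range fun z : F × H => EH.tmul φ hφ z.1 z.2) :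
      Set (EH F φ hφ)) := by
  refine (EH.denseRange_of (E := F) (φ := φ) (hφ := hφ)).mono ?_
  rintro _ ⟨ξ, rfl⟩
  induction ξ using PreTensor.induction with
  | h0 x h => exact Submodule.subset_span ⟨(x, h), rfl⟩
  | hadd ξ η h h' => rw [map_add]; exact Submodule.add_mem _ h h'

variable {A : Type*} [LocallyCStarAlgebra A]
  {E : Type*} [AddCommGroup E] [Module ℂ E] [SMul Bᵐᵒᵖ E] [PreHilbertModule B E]
  {V : Type*} [AddCommGroup V] [Module ℂ V] [SMul Aᵐᵒᵖ V] [SemiHilbertModule A V]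
  {Ψ : A →⋆ₙₐ[ℂ] L B E} {hΨ : Continuous Ψ}

theorem Interior.bar_continuous (q : S B) :
    Continuous fun z : Interior V Ψ hΨ => bar q z :=
  Real.continuous_sqrt.comp
    (q.continuous.comp (Interior.continuous_inner₂ continuous_id continuous_id))

theorem EH.continuous_tmul_interior (h : H) :
    Continuous fun z : Interior V Ψ hΨ => EH.tmul φ hφ z h := by
  obtain ⟨q, C, hC, hq⟩ := exists_bound_rep_sq hφ
  -- `z ↦ z ⊗ h` is additive, so it suffices to treat the point `0`.
  let f : Interior V Ψ hΨ →+ EH (Interior V Ψ hΨ) φ hφ :=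
    AddMonoidHom.mk' (fun z => EH.tmul φ hφ z h) fun z w =>
      (congrArg (EH.of _ φ hφ) (TensorProduct.add_tmul z w h)).trans (map_add _ _ _)
  refine continuous_of_continuousAt_zero f ?_
  rw [ContinuousAt, map_zero, tendsto_zero_iff_norm_tendsto_zero]
  have h1 : Tendsto (fun z : Interior V Ψ hΨ => C * bar q z * ‖h‖) (𝓝 0) (𝓝 0) := by
    have := (((Interior.bar_continuous (V := V) (hΨ := hΨ) q).const_mul C).mul_const ‖h‖).tendsto 0
    simpa only [map_zero, mul_zero, zero_mul] using this
  exact squeeze_zero (fun _ => norm_nonneg _)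
    (fun z => (EH.norm_of _).trans_le (PreTensor.norm_tmul_le hC hq z h)) h1

theorem EH.dense_span_tmul_interior :
    Dense (Submodule.span ℂ (Set.range fun z : V × E × H =>
      EH.tmul φ hφ (Interior.tmul Ψ hΨ z.1 z.2.1) z.2.2) : Set (EH (Interior V Ψ hΨ) φ hφ)) := by
  rw [Submodule.dense_iff_topologicalClosure_eq_top, eq_top_iff,
    ← (Submodule.dense_iff_topologicalClosure_eq_top.1 (EH.dense_span_tmul φ hφ))]
  refine Submodule.topologicalClosure_minimal _ (Submodule.span_le.2 ?_)
    (Submodule.isClosed_topologicalClosure _)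
  rintro _ ⟨⟨z, h⟩, rfl⟩
  change EH.tmul φ hφ z h ∈ _
  induction z using Interior.induction with
  | hP =>
    exact (Submodule.isClosed_topologicalClosure _).preimage (EH.continuous_tmul_interior φ hφ h)
  | h ξ =>
    refine Submodule.le_topologicalClosure _ ?_
    induction ξ using TensorProduct.induction_on with
    | zero =>
      have : EH.tmul φ hφ (Interior.of V Ψ hΨ 0) h = 0 := by
        rw [map_zero]
        exact (congrArg (EH.of _ φ hφ) (TensorProduct.zero_tmul _ h)).trans (map_zero _)
      exact this ▸ Submodule.zero_mem _
    | tmul v x => exact Submodule.subset_span ⟨(v, x, h), rfl⟩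
    | add ξ η h1 h2 =>
      have : EH.tmul φ hφ (Interior.of V Ψ hΨ ξ + Interior.of V Ψ hΨ η) h =
          EH.tmul φ hφ (Interior.of V Ψ hΨ ξ) h + EH.tmul φ hφ (Interior.of V Ψ hΨ η) h :=
        (congrArg (EH.of _ φ hφ) (TensorProduct.add_tmul _ _ h)).trans (map_add _ _ _)
      have h3 := map_add (Interior.of V Ψ hΨ) ξ η
      exact (congrArg (EH.tmul φ hφ · h) h3).trans this ▸ Submodule.add_mem _ h1 h2

end Total

/-! ### The morphism `Ψ_p : A_p → L_{B_q}(E_q)` -/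

section Descend

variable {A B : Type*} [LocallyCStarAlgebra A] [LocallyCStarAlgebra B]
  {E : Type*} [AddCommGroup E] [Module ℂ E] [SMul Bᵐᵒᵖ E] [PreHilbertModule B E]

theorem pushforward_add (q : S B) (T R : L B E) :
    pushforward q (T + R) = pushforward q T + pushforward q R :=
  L.ext <| ModQuo.ind fun x => map_add (σ q E) (T x) (R x)

theorem pushforward_smul (q : S B) (c : ℂ) (T : L B E) :
    pushforward q (c • T) = c • pushforward q T :=
  L.ext <| ModQuo.ind fun x => map_smul (σ q E) c (T x)

theorem pushforward_mul (q : S B) (T R : L B E) :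
    pushforward q (T * R) = pushforward q T * pushforward q R :=
  L.ext <| ModQuo.ind fun _ => rfl

theorem pushforward_star (q : S B) (T : L B E) :
    pushforward q (star T) = star (pushforward q T) :=
  L.eq_star_of_inner <| ModQuo.ind fun x => ModQuo.ind fun y =>
    congrArg (π q) (T.inner_left x y)

theorem pushforward_eq_zero {q : S B} {T : L B E} (h : tilde q T = 0) : pushforward q T = 0 :=
  L.ext <| ModQuo.ind fun x => σ_eq_zero.2 <| le_antisymm
    ((bar_le_tilde q T x).trans (by rw [h, zero_mul])) (apply_nonneg _ _)

/-- The ⋆-morphism `Ψ_p : A_p → L_{B_q}(E_q)` with `Ψ_p ∘ π_p = (π_q)_* ∘ Ψ`, for `p ∈ S(A)` such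
that `p a = 0` implies `q̃(Ψ a) = 0`. -/
def descend (Ψ : A →⋆ₙₐ[ℂ] L B E) (p : S A) (q : S B)
    (h : ∀ a, p a = 0 → tilde q (Ψ a) = 0) : Quo p →⋆ₙₐ[ℂ] L (Quo q) (ModQuo q E) where
  toFun := SeparationQuotient.lift (X := WithS p) (fun a : A => pushforward q (Ψ a)) (by
    intro (a : A) (b : A) hab
    have h1 : pushforward q (Ψ (a - b)) = 0 :=
      pushforward_eq_zero (h _ (S.sub_eq_zero (SeparationQuotient.mk_eq_mk.2 hab)))
    have h2 : a = a - b + b := (sub_add_cancel a b).symm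
    change pushforward q (Ψ a) = pushforward q (Ψ b)
    rw [h2, map_add, pushforward_add, h1, zero_add])
  map_smul' c := Quo.ind fun a =>
    (congrArg (pushforward q) (map_smul Ψ c a)).trans (pushforward_smul q c _)
  map_zero' := by
    refine (congrArg (pushforward q) (map_zero Ψ)).trans ?_
    have := pushforward_smul q 0 (0 : L B E)
    rwa [zero_smul, zero_smul] at this
  map_add' := Quo.ind fun a => Quo.ind fun b =>
    (congrArg (pushforward q) (map_add Ψ a b)).trans (pushforward_add q _ _)
  map_mul' := Quo.ind fun a => Quo.ind fun b =>
    (congrArg (pushforward q) (map_mul Ψ a b)).trans (pushforward_mul q _ _)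
  map_star' := Quo.ind fun a =>
    (congrArg (pushforward q) (map_star Ψ a)).trans (pushforward_star q _)

theorem descend_π (Ψ : A →⋆ₙₐ[ℂ] L B E) (p : S A) (q : S B)
    (h : ∀ a, p a = 0 → tilde q (Ψ a) = 0) (a : A) :
    descend Ψ p q h (π p a) = pushforward q (Ψ a) := rfl

theorem pullS_le {q : S B} (r : S (Quo q)) (b : B) : pullS r b ≤ q b := by
  have h : ∀ c : Quo q, ‖π r c‖ ≤ ‖c‖ := NonUnitalStarAlgHom.norm_apply_le (π r)
  exact h (π q b)

theorem bar_pullS_le {q : S B} (r : S (Quo q)) (x : E) : bar (pullS r) x ≤ bar q x :=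
  Real.sqrt_le_sqrt (pullS_le r _)

theorem bar_pow_le (q : S B) (R : L B E) (n : ℕ) (x : E) :
    bar q ((R ^ n : L B E) x) ≤ tilde q R ^ n * bar q x := by
  induction n with
  | zero => rw [pow_zero, pow_zero, one_mul]; rfl
  | succ n ih =>
    rw [pow_succ', pow_succ', mul_assoc, L.mul_apply]
    exact (bar_le_tilde q R _).trans (mul_le_mul_of_nonneg_left ih (apply_nonneg _ _))

/-- A self-adjoint operator is bounded for the smaller seminorm `pullS r` of `E` by the constant
`q̃(R)` of the larger one: iterating the Cauchy-Schwarz inequality compares both constants with the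
growth of the powers of `R`. -/
theorem bar_pullS_apply_le {q : S B} (r : S (Quo q)) {R : L B E} (hR : star R = R) (x : E) :
    bar (pullS r) (R x) ≤ tilde q R * bar (pullS r) x := by
  have hs : ∀ n : ℕ, star (R ^ n) = R ^ n := fun n => by rw [star_pow, hR]
  have := le_of_iterate_bound (a := fun n => bar (pullS r) ((R ^ n : L B E) x)) (K := tilde q R)
    (M := bar q x) (fun n => apply_nonneg _ _) (fun n => ?_) (apply_nonneg _ _)
    (fun n => (bar_pullS_le r _).trans ((bar_pow_le q R n x).trans_eq (mul_comm _ _)))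
  · simpa only [pow_one, pow_zero, L.one_apply] using this
  · rw [bar_sq, L.inner_left, hs, ← L.mul_apply, ← pow_add, ← two_mul]
    exact le_bar_mul_bar _ _ _

theorem bar_pullS_apply_sq_le {q : S B} (r : S (Quo q)) (T : L B E) (x : E) :
    bar (pullS r) (T x) ^ 2 ≤ tilde q (star T * T) * bar (pullS r) x ^ 2 := by
  rw [bar_sq, L.inner_left, ← L.mul_apply]
  refine (le_bar_mul_bar _ _ _).trans ?_
  refine (mul_le_mul_of_nonneg_left (bar_pullS_apply_le r (R := star T * T)
    (by rw [star_mul, star_star]) x) (apply_nonneg _ _)).trans_eq ?_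
  ring

theorem descend_continuous {Ψ : A →⋆ₙₐ[ℂ] L B E} {p : S A} {q : S B}
    (h : ∀ a, p a = 0 → tilde q (Ψ a) = 0) {C : ℝ} (hC : 0 ≤ C)
    (hp : ∀ a, tilde q (Ψ a) ≤ C * p a) : Continuous (descend Ψ p q h) := by
  refine continuous_iInf_rng.2 fun r => ?_
  let _ := (tilde (E := ModQuo q E) r).toSeminormedAddCommGroup
  refine AddMonoidHomClass.continuous_of_bound (descend Ψ p q h) (√C) (Quo.ind fun a => ?_)
  refine ContinuousLinearMap.opNorm_le_bound _ (by positivity)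
    (ModQuo.ind <| ModQuo.ind fun x => ?_)
  change bar (pullS r) (Ψ a x) ≤ √C * p a * bar (pullS r) x
  refine le_of_sq_le_sq ((bar_pullS_apply_sq_le r (Ψ a) x).trans ?_)
    (mul_nonneg (mul_nonneg (Real.sqrt_nonneg C) (apply_nonneg _ _)) (apply_nonneg _ _))
  have h1 : star (Ψ a) * Ψ a = Ψ (star a * a) := by rw [map_mul, map_star]
  rw [mul_pow, mul_pow, Real.sq_sqrt hC, ← p.star_mul_self, h1]
  exact mul_le_mul_of_nonneg_right (hp _) (sq_nonneg _)

variable (E) in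
theorem σ_continuous (q : S B) :
    @Continuous E (ModQuo q E) (hilbertTopology B E) (hilbertTopology (Quo q) (ModQuo q E))
      (σ q E) := by
  let _ : UniformSpace E := hilbertUniformSpace B E
  have h : @UniformContinuous E (ModQuo q E) (hilbertUniformSpace B E)
      (hilbertUniformSpace (Quo q) (ModQuo q E)) (σ q E) := by
    refine uniformContinuous_iInf_rng.2 fun r => uniformContinuous_iInf_dom (i := pullS r) ?_
    let _ := (bar (E := E) (pullS r)).toSeminormedAddCommGroup
    let _ := (bar (E := ModQuo q E) r).toSeminormedAddCommGroup
    exact AddMonoidHomClass.uniformContinuous_of_bound (σ q E) 1 fun x => (one_mul _).ge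
  exact @UniformContinuous.continuous E _ (hilbertUniformSpace B E)
    (hilbertUniformSpace (Quo q) (ModQuo q E)) _ h

theorem descend_nondegenerate {Ψ : A →⋆ₙₐ[ℂ] L B E} (hΨ : IsNondegenerateAction Ψ) {p : S A}
    {q : S B} (h : ∀ a, p a = 0 → tilde q (Ψ a) = 0) :
    IsNondegenerateAction (descend Ψ p q h) := by
  have h1 := @DenseRange.dense_image E (ModQuo q E) (hilbertTopology B E)
    (hilbertTopology (Quo q) (ModQuo q E)) _ _
    (@Function.Surjective.denseRange (ModQuo q E) (hilbertTopology (Quo q) (ModQuo q E)) E _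
      (σ_surjective q)) (σ_continuous E q) hΨ
  refine @Dense.mono _ (hilbertTopology (Quo q) (ModQuo q E)) _ _ ?_ h1
  rw [← Submodule.map_coe, Submodule.map_span, ← Set.range_comp]
  refine Submodule.span_mono ?_
  rintro _ ⟨⟨a, x⟩, rfl⟩
  exact ⟨(π p a, σ q E x), rfl⟩

end Descend

/-! ### The unitary equivalence -/

section Equivalence

variable {A B : Type*} [LocallyCStarAlgebra A] [LocallyCStarAlgebra B]
  {V : Type*} [AddCommGroup V] [Module ℂ V] [SMul Aᵐᵒᵖ V] [SemiHilbertModule A V]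
  {W : Type*} [AddCommGroup W] [Module ℂ W] [SMul Bᵐᵒᵖ W] [SemiHilbertModule B W]
  {E : Type*} [AddCommGroup E] [Module ℂ E] [SMul Bᵐᵒᵖ E] [PreHilbertModule B E]
  {H : Type*} [NormedAddCommGroup H] [InnerProductSpace ℂ H] [CompleteSpace H]
  {K : Type*} [NormedAddCommGroup K] [InnerProductSpace ℂ K] [CompleteSpace K]

/-- If `φ_q ∘ π_q = φ` and `Ψ_p ∘ π_p = (π_q)_* ∘ Ψ`, the representations induced from `W` via `E`
and from `W_q` via `E_q` are equivalent: `x ⊗ h ↦ σ_q x ⊗ h` and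
`v ⊗ x ⊗ h ↦ σ_p v ⊗ σ_q x ⊗ h` preserve the inner products of total families. -/
theorem inducedRep_unitarilyEquivalent (Φ : HilbertRep B W H K) {q : S B}
    (Φq : HilbertRep (Quo q) (ModQuo q W) H K) (hφ : ∀ b, Φq.φ (π q b) = Φ.φ b)
    {Ψ : A →⋆ₙₐ[ℂ] L B E} (hΨ : Continuous Ψ) {p : S A}
    {Ψp : Quo p →⋆ₙₐ[ℂ] L (Quo q) (ModQuo q E)} (hΨp : Continuous Ψp)
    (hp : ∀ a, Ψp (π p a) = pushforward q (Ψ a)) :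
    HilbertRep.UnitarilyEquivalent (inducedRep V Ψ hΨ Φ)
      (HilbertRep.compσ (inducedRep (ModQuo p V) Ψp hΨp Φq)) := by
  obtain ⟨U₁, hU₁⟩ := exists_unitary_of_gram_eq
    (k := fun z : E × H => EH.tmul Φ.φ Φ.continuous_φ z.1 z.2)
    (l := fun z : E × H => EH.tmul Φq.φ Φq.continuous_φ (σ q E z.1) z.2)
    (EH.dense_span_tmul Φ.φ Φ.continuous_φ)
    (by
      convert EH.dense_span_tmul (F := ModQuo q E) Φq.φ Φq.continuous_φ using 3
      exact ((σ_surjective q).prodMap Function.surjective_id).range_comp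
        fun z : ModQuo q E × H => EH.tmul Φq.φ Φq.continuous_φ z.1 z.2)
    (fun z w => by rw [EH.inner_tmul, EH.inner_tmul, inner_σ, hφ])
  obtain ⟨U₂, hU₂⟩ := exists_unitary_of_gram_eq
    (k := fun z : V × E × H =>
      EH.tmul Φ.φ Φ.continuous_φ (Interior.tmul Ψ hΨ z.1 z.2.1) z.2.2)
    (l := fun z : V × E × H =>
      EH.tmul Φq.φ Φq.continuous_φ (Interior.tmul Ψp hΨp (σ p V z.1) (σ q E z.2.1)) z.2.2)
    (EH.dense_span_tmul_interior Φ.φ Φ.continuous_φ)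
    (by
      convert EH.dense_span_tmul_interior (V := ModQuo p V) (hΨ := hΨp) Φq.φ Φq.continuous_φ
        using 3
      exact ((σ_surjective p).prodMap ((σ_surjective q).prodMap
        Function.surjective_id)).range_comp fun z : ModQuo p V × ModQuo q E × H =>
          EH.tmul Φq.φ Φq.continuous_φ (Interior.tmul Ψp hΨp z.1 z.2.1) z.2.2)
    (fun z w => by
      rw [EH.inner_tmul, EH.inner_tmul, Interior.inner_tmul, Interior.inner_tmul, inner_σ, hp,
        pushforward_σ, inner_σ, hφ])
  refine ⟨U₁, U₂, fun v ξ => ?_⟩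
  -- Both sides are bounded operators, so it suffices to compare them on the vectors `x ⊗ h`.
  let f := U₂.toContinuousLinearEquiv.toContinuousLinearMap ∘L inducedRep V Ψ hΨ Φ v
  let g := inducedRep (ModQuo p V) Ψp hΨp Φq (σ p V v) ∘L
    U₁.toContinuousLinearEquiv.toContinuousLinearMap
  have hfg : f = g := by
    refine ContinuousLinearMap.ext_on (EH.dense_span_tmul Φ.φ Φ.continuous_φ) ?_
    rintro _ ⟨⟨x, h⟩, rfl⟩
    change U₂ (inducedRep V Ψ hΨ Φ v (EH.tmul _ _ x h)) =
      inducedRep (ModQuo p V) Ψp hΨp Φq (σ p V v) (U₁ (EH.tmul _ _ x h))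
    rw [hU₁ (x, h), inducedRep_tmul, inducedRep_tmul, hU₂ (v, x, h)]
  exact congrArg (· ξ) hfg

end Equivalence

end

end LocCStar

theorem theorem3p7
    {A B : Type*} [LocallyCStarAlgebra A] [LocallyCStarAlgebra B]
    {V : Type*} [AddCommGroup V] [Module ℂ V] [SMul Aᵐᵒᵖ V] [HilbertModule A V]
    {W : Type*} [AddCommGroup W] [Module ℂ W] [SMul Bᵐᵒᵖ W] [HilbertModule B W]
    {E : Type*} [AddCommGroup E] [Module ℂ E] [SMul Bᵐᵒᵖ E] [HilbertModule B E]
    {H : Type*} [NormedAddCommGroup H] [InnerProductSpace ℂ H] [CompleteSpace H]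
    {K : Type*} [NormedAddCommGroup K] [InnerProductSpace ℂ K] [CompleteSpace K]
    (hV : IsFull A V) (hW : IsFull B W)
    (Ψ : A →⋆ₙₐ[ℂ] L B E) (hΨ : Continuous Ψ) (hΨn : IsNondegenerateAction Ψ)
    (Φ : HilbertRep B W H K) (hΦ : Φ.Nondegenerate)
    (q : S B) (φq : Quo q →⋆ₙₐ[ℂ] (H →L[ℂ] H)) (hφq : ∀ b : B, φq (π q b) = Φ.φ b)
    (hφqn : IsNondegenerateRep φq) :
    ∃ (p : S A) (Ψp : Quo p →⋆ₙₐ[ℂ] L (Quo q) (ModQuo q E)) (hΨp : Continuous Ψp),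
      (∀ a : A, Ψp (π p a) = pushforward q (Ψ a)) ∧
      IsNondegenerateAction Ψp ∧
      HilbertRep.UnitarilyEquivalent (inducedRep V Ψ hΨ Φ)
        (HilbertRep.compσ (inducedRep (ModQuo p V) Ψp hΨp (Φ.assoc q φq hφq))) := by
  obtain ⟨p, C, hC, hp⟩ := exists_tilde_le hΨ q
  have h0 : ∀ a, p a = 0 → tilde q (Ψ a) = 0 := fun a ha =>
    le_antisymm ((hp a).trans (by rw [ha, mul_zero])) (apply_nonneg _ _)
  have hΨp := descend_continuous h0 hC hp
  exact ⟨p, descend Ψ p q h0, hΨp, descend_π Ψ p q h0, descend_nondegenerate hΨn h0,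
    inducedRep_unitarilyEquivalent Φ (Φ.assoc q φq hφq) hφq hΨ hΨp (descend_π Ψ p q h0)⟩
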